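/- Let $K$ be a field. All hypergraphs and presentations below are finite. **Hypergraphs.** A hypergraph $H=(H^0,H^1,s,r)$ consists of finite sets $H^0$ (vertices) and $H^1$ (hyperedges) and of maps $s,r$ assigning to each $h\in H^1$ nonempty multisets $s(h),r(h):H^0\to\mathbb N_0$. For $h\in H^1$ put $I_h=\{(u,k)\mid 1\le k\le s(h)(u)\}$ and $J_h=\{(v,l)\mid 1\le l\le r(h)(v)\}$. The Leavitt path algebra $L(H)$ is the $K$-algebra with generators $v$, $h_{ij}$, $h_{ij}^*$ ($v\in H^0$, $h\in H^1$, $i\in I_h$, $j\in J_h$) and relations: $uv=\delta_{uv}u$ for $u,v\in H^0$, with $\sum_{v\in H^0}v=1$; $uh_{ij}=h_{ij}=h_{ij}v$ and $vh_{ij}^*=h_{ij}^*=h_{ij}^*u$ for $i=(u,k)$, $j=(v,l)$; $\sum_{j\in J_h}h_{ij}h_{i'j}^*=\delta_{ii'}u$ for $i=(u,k),i'\in I_h$; $\sum_{i\in I_h}h_{ij}^*h_{ij'}=\delta_{jj'}v$ for $j=(v,l),j'\in J_h$. **Bergman presentations and Bergman graphs.** A Bergman presentation is a family $R=\{a_i=b_i\mid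 i\in I\}$ of pairs of nonzero elements of the free abelian monoid $\langle X\rangle$ ($X$, $I$ finite) with a partition $I=I_{\rm blue}\sqcup I_{\rm red}$ such that (i) for $i\in I_{\rm blue}$, $b_i$ is the sum of the elements of a set $X_i\subseteq X$ with $|X_i|\ge 2$, and the sets $X_i$ are pairwise disjoint; (ii) there is an ordering $i_1,\dots,i_m$ of $I_{\rm blue}$ such that all summands of $a_{i_k}$ lie in $X_{\rm base}\cup X_{i_1}\cup\dots\cup X_{i_{k-1}}$, where $X_{\rm base}=X\setminus\bigcup_{i\in I_{\rm blue}}X_i$. It is basic if $X=X_{\rm base}$. A Bergman graph is a hypergraph $H$ with a partition $H^1=H^1_{\rm blue}\sqcup H^1_{\rm red}$ such that $X=H^0$, $I=H^1$ and the relations $\sum_v s(h)(v)\,v=\sum_v r(h)(v)\,v$ form a Bergman presentation $\beta(H)$; $H$ is basic if $\beta(H)$ is basic. **Bergman algebras.** The Bergman algebra $B(X,R)$ is obtained from $K^{X_{\rm base}}$ by adjoining, for each blue relation $a_i=b_i$, a universal decomposition of the projective module of $a_i$ into a direct sum indexed by $X_i$, and then, for each red relation $a_i=b_i$, a universal isomorphism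 between the projective modules of $a_i$ and $b_i$. Explicitly, it is the $K$-algebra generated by the entries of matrices $\epsilon_x$ ($x\in X$) and $\sigma_i,\sigma_i'$ ($i\in I_{\rm red}$), where $\epsilon_c$ denotes the block diagonal sum of the $\epsilon_y$ over the summands $y$ of $c\in\langle X\rangle$ with multiplicity, $\epsilon_x$ is $1\times1$ for $x\in X_{\rm base}$ and has the size of $\epsilon_{a_i}$ for $x\in X_i$, subject to: $\epsilon_x\epsilon_y=\delta_{xy}\epsilon_x$ for $x,y\in X_{\rm base}$ and $\sum_{x\in X_{\rm base}}\epsilon_x=1$; $\epsilon_x\epsilon_y=\delta_{xy}\epsilon_x$ for $x,y\in X_i$ and $\sum_{x\in X_i}\epsilon_x=\epsilon_{a_i}$ for $i\in I_{\rm blue}$; $\epsilon_{a_i}\sigma_i\epsilon_{b_i}=\sigma_i$, $\epsilon_{b_i}\sigma_i'\epsilon_{a_i}=\sigma_i'$, $\sigma_i\sigma_i'=\epsilon_{a_i}$, $\sigma_i'\sigma_i=\epsilon_{b_i}$ for $i\in I_{\rm red}$. For a Bergman graph, $B(H)=B(\beta(H))$. **Theorem.** (a) Let $H$ be a basic Bergman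 graph, $v\in H^0$ a lonely vertex and $h\in H^1$ the corresponding hyperedge: $s(h)=\{v\}$ (with multiplicity one), $v$ is not a range of $h$, and $v$ is neither a source nor a range of any hyperedge $g\ne h$. Let $H'$ be the basic Bergman graph obtained from $H$ by removing $v$ and $h$. Then $B(H')$ and $B(H)$ are Morita equivalent, i.e. their module categories are equivalent ($K$-linearly). Moreover, $e=\sum_{u\in H^0\setminus\{v\}}u$ is an idempotent of $L(H)$ which is full, i.e. $L(H)eL(H)=L(H)$, and $L(H')$ is isomorphic as a $K$-algebra to the corner $eL(H)e$. (b) Let $(X,R)$ be a basic Bergman presentation, $x\in X$ a lonely generator and $i\in I$ the corresponding index: $a_i=x$, $x$ is not a summand of $b_i$, and $x$ is not a summand of $a_j$ or $b_j$ for any $j\in I\setminus\{i\}$. Let $(X',R')$ be the basic Bergman presentation obtained from $(X,R)$ by removing the generator $x$ and the relation $a_i=b_i$. Then $B(X',R')$ and $B(X,R)$ are ($K$-linearly) Morita equivalent. -/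

import Mathlib

/-! ### Hypergraphs and Leavitt path algebras of hypergraphs -/

/-- The index set `{(v, k) | 1 ≤ k ≤ m v}` of a multiset `m : V → ℕ`, that is, the occurrences of
elements in `m`. -/
structure MultIndex {V : Type*} (m : V → ℕ) where
  elt : V
  occ : Fin (m elt)

instance {V : Type*} [Finite V] (m : V → ℕ) : Finite (MultIndex m) :=
  Finite.of_surjective (fun p : (v : V) × Fin (m v) => (⟨p.1, p.2⟩ : MultIndex m))
    fun q => ⟨⟨q.elt, q.occ⟩, rfl⟩

noncomputable instance {V : Type*} [Finite V] (m : V → ℕ) : Fintype (MultIndex m) :=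
  Fintype.ofFinite _

/-- A hypergraph with vertex set `V` and hyperedge set `E`: every hyperedge has a nonempty
multiset of sources and a nonempty multiset of ranges. Finiteness of `V` and `E` is expressed by
instances `[Finite V] [Finite E]`. -/
structure OrientedHypergraph (V E : Type*) where
  s : E → V → ℕ
  r : E → V → ℕ
  s_nonempty : ∀ h, ∃ v, s h v ≠ 0
  r_nonempty : ∀ h, ∃ v, r h v ≠ 0

namespace OrientedHypergraph

variable {V E : Type*}

/-- The generators `v`, `h_{ij}`, `h_{ij}^*` of the Leavitt path algebra of a hypergraph. -/
inductive LGen (H : OrientedHypergraph V E) : Type _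
  | vert (v : V) : LGen H
  | edge (h : E) (i : MultIndex (H.s h)) (j : MultIndex (H.r h)) : LGen H
  | ghost (h : E) (i : MultIndex (H.s h)) (j : MultIndex (H.r h)) : LGen H

section Leavitt

variable [Finite V] (K : Type*) [Field K] (H : OrientedHypergraph V E)

noncomputable def preVert (v : V) : FreeAlgebra K H.LGen :=
  FreeAlgebra.ι K (LGen.vert v)

noncomputable def preEdge (h : E) (i : MultIndex (H.s h)) (j : MultIndex (H.r h)) :
    FreeAlgebra K H.LGen :=
  FreeAlgebra.ι K (LGen.edge h i j)

noncomputable def preGhost (h : E) (i : MultIndex (H.s h)) (j : MultIndex (H.r h)) :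
    FreeAlgebra K H.LGen :=
  FreeAlgebra.ι K (LGen.ghost h i j)

open Classical in
/-- The defining relations of the Leavitt path algebra. As `V` is finite, the nonunital algebra
given by the relations other than `sum_vert` is unital with unit the sum of all vertices, so that
as a unital algebra it is given by these relations together with `sum_vert`. -/
inductive LRel : FreeAlgebra K H.LGen → FreeAlgebra K H.LGen → Prop
  | vert_mul (u v : V) :
      LRel (preVert K H u * preVert K H v) (if u = v then preVert K H u else 0)
  | sum_vert : LRel (∑ᶠ v : V, preVert K H v) 1
  | vert_edge (h : E) (i : MultIndex (H.s h)) (j : MultIndex (H.r h)) :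
      LRel (preVert K H i.elt * preEdge K H h i j) (preEdge K H h i j)
  | edge_vert (h : E) (i : MultIndex (H.s h)) (j : MultIndex (H.r h)) :
      LRel (preEdge K H h i j * preVert K H j.elt) (preEdge K H h i j)
  | vert_ghost (h : E) (i : MultIndex (H.s h)) (j : MultIndex (H.r h)) :
      LRel (preVert K H j.elt * preGhost K H h i j) (preGhost K H h i j)
  | ghost_vert (h : E) (i : MultIndex (H.s h)) (j : MultIndex (H.r h)) :
      LRel (preGhost K H h i j * preVert K H i.elt) (preGhost K H h i j)
  | edge_ghost (h : E) (i i' : MultIndex (H.s h)) :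
      LRel (∑ j : MultIndex (H.r h), preEdge K H h i j * preGhost K H h i' j)
        (if i = i' then preVert K H i.elt else 0)
  | ghost_edge (h : E) (j j' : MultIndex (H.r h)) :
      LRel (∑ i : MultIndex (H.s h), preGhost K H h i j * preEdge K H h i j')
        (if j = j' then preVert K H j.elt else 0)

/-- The Leavitt path algebra `L(H)` of a hypergraph with finitely many vertices. -/
abbrev LeavittPathAlgebra : Type _ := RingQuot (LRel K H)

/-- A vertex as an element of `L(H)`. -/
noncomputable def vertL (v : V) : LeavittPathAlgebra K H :=
  RingQuot.mkAlgHom K (LRel K H) (preVert K H v)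

/-- The sum in `L(H)` of all vertices other than `v`. -/
noncomputable def coVertL (v : V) : LeavittPathAlgebra K H :=
  ∑ᶠ u : {u : V // u ≠ v}, vertL K H u.1

end Leavitt

end OrientedHypergraph

/-! ### Bergman presentations and Bergman graphs -/

/-- A presentation `⟨x ∈ X | a_i = b_i (i ∈ I)⟩` of an abelian monoid; the free abelian monoid
on `X` is `X →₀ ℕ`. -/
structure AbelianMonoidPresentation (X I : Type*) where
  a : I → X →₀ ℕ
  b : I → X →₀ ℕ

/-- The base generators with respect to a set of blue relations: those that occur in no right
hand side of a blue relation. -/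
def AbelianMonoidPresentation.baseSet {X I : Type*} (P : AbelianMonoidPresentation X I)
    (blue : Set I) : Set X :=
  {x | ∀ i ∈ blue, P.b i x = 0}

/-- A Bergman presentation (finiteness of `X` and `I` is expressed by instances). The red
relations are those which are not blue. -/
structure BergmanPresentation (X I : Type*) extends AbelianMonoidPresentation X I where
  a_ne_zero : ∀ i, a i ≠ 0
  b_ne_zero : ∀ i, b i ≠ 0
  blue : Set I
  /-- the right hand side of a blue relation is a sum of distinct generators … -/
  blue_mult : ∀ i ∈ blue, ∀ x, b i x ≤ 1
  /-- … at least two in number … -/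
  blue_card : ∀ i ∈ blue, 2 ≤ (b i).support.card
  /-- … and different blue relations have no generator of their right hand sides in common. -/
  blue_disjoint : ∀ i ∈ blue, ∀ j ∈ blue, i ≠ j → Disjoint (b i).support (b j).support
  /-- there is an admissible ordering of the blue relations. -/
  admissible : ∃ (m : ℕ) (o : Fin m ≃ blue), ∀ k : Fin m, ∀ x ∈ (a (o k)).support,
    x ∈ toAbelianMonoidPresentation.baseSet blue ∨ ∃ p < k, x ∈ (b (o p)).support

/-- A Bergman graph (finiteness of `V` and `E` is expressed by instances). The red hyperedges
are those which are not blue. -/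
structure BergmanGraph (V E : Type*) extends OrientedHypergraph V E where
  blue : Set E
  /-- the range multiset of a blue hyperedge is a set … -/
  blue_mult : ∀ h ∈ blue, ∀ v, r h v ≤ 1
  /-- … with at least two elements … -/
  blue_card : ∀ h ∈ blue, 2 ≤ (Function.support (r h)).ncard
  /-- … and different blue hyperedges have disjoint ranges. -/
  blue_disjoint : ∀ h ∈ blue, ∀ g ∈ blue, h ≠ g →
    Disjoint (Function.support (r h)) (Function.support (r g))
  /-- there is an admissible ordering of the blue hyperedges. -/
  admissible : ∃ (m : ℕ) (o : Fin m ≃ blue), ∀ k : Fin m, ∀ v ∈ Function.support (s (o k)),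
    (∀ g ∈ blue, r g v = 0) ∨ ∃ p < k, v ∈ Function.support (r (o p))

namespace BergmanPresentation

variable {X I : Type*}

/-- The set of base generators. -/
def base (P : BergmanPresentation X I) : Set X :=
  P.toAbelianMonoidPresentation.baseSet P.blue

/-- A Bergman presentation is basic if all its generators are base generators. -/
def IsBasic (P : BergmanPresentation X I) : Prop := P.base = Set.univ

theorem IsBasic.blue_eq {P : BergmanPresentation X I} (hP : P.IsBasic) (i : I) :
    i ∉ P.blue := by
  intro hi
  apply P.b_ne_zero i
  ext x
  have hx : x ∈ P.base := by rw [hP]; trivial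
  exact hx i hi

/-! ### The Bergman algebra

The idempotent matrix `ε_x` attached to a generator `x` is a `1 × 1` matrix if `x` is a base
generator, and has the size of the block diagonal matrix `ε_{a_i}` if `x` is a summand of the
right hand side `b_i` of a blue relation. Here `ε_c = ⨁ ε_y`, where `y` runs through the summands
of `c`, counted with multiplicity. -/

/-- The set of row (and column) indices of the matrix `ε_x`. -/
inductive Idx (P : BergmanPresentation X I) : X → Type _
  | base (x : X) (hx : x ∈ P.base) : Idx P x
  | step (i : I) (hi : i ∈ P.blue) (x : X) (hx : x ∈ (P.b i).support)
      (y : MultIndex (P.a i)) (p : Idx P y.elt) : Idx P x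

/-- The set of row (and column) indices of the matrix `ε_c`. -/
structure SumIdx (P : BergmanPresentation X I) (c : X →₀ ℕ) where
  summand : MultIndex c
  idx : P.Idx summand.elt

theorem finite_idx_of_mem_base (P : BergmanPresentation X I) (x : X) (hx : x ∈ P.base) :
    Finite (P.Idx x) := by
  have : Subsingleton (P.Idx x) := by
    refine ⟨fun p q => ?_⟩
    cases p with
    | step i hi _ hx' y p => exact absurd (hx i hi) (Finsupp.mem_support_iff.1 hx')
    | base =>
      cases q with
      | step i hi _ hx' y p => exact absurd (hx i hi) (Finsupp.mem_support_iff.1 hx')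
      | base => rfl
  infer_instance

theorem finite_idx [Finite X] (P : BergmanPresentation X I) (x : X) : Finite (P.Idx x) := by
  obtain ⟨m, o, ho⟩ := P.admissible
  have key : ∀ n : ℕ, ∀ k : Fin m, k.1 = n → ∀ z ∈ (P.b (o k)).support,
      Finite (P.Idx z) := by
    intro n
    induction n using Nat.strong_induction_on with
    | _ n ih =>
      intro k hk z hz
      have hfin : ∀ y : MultIndex (P.a (o k)), Finite (P.Idx y.elt) := by
        intro y
        have hy : y.elt ∈ (P.a (o k)).support := by
          rw [Finsupp.mem_support_iff]
          exact (Fin.pos y.occ).ne'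
        rcases ho k y.elt hy with h | ⟨p, hp, h⟩
        · exact P.finite_idx_of_mem_base _ h
        · exact ih p.1 (hk ▸ hp) p rfl _ h
      let f : ((y : MultIndex (P.a (o k))) × P.Idx y.elt) → P.Idx z :=
        fun q => Idx.step (P := P) (o k) (o k).2 z hz q.1 q.2
      refine Finite.of_surjective f ?_
      intro q
      cases q with
      | base _ hb => exact absurd (hb (o k) (o k).2) (Finsupp.mem_support_iff.1 hz)
      | step i hi _ hx y p =>
        have : i = (o k : I) := by
          by_contra hne
          exact Finset.disjoint_left.1 (P.blue_disjoint i hi _ (o k).2 hne) hx hz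
        subst this
        exact ⟨⟨y, p⟩, rfl⟩
  by_cases hx : x ∈ P.base
  · exact P.finite_idx_of_mem_base x hx
  · have : ∃ i ∈ P.blue, P.b i x ≠ 0 := by
      by_contra hcon
      apply hx
      intro i hi
      by_contra h
      exact hcon ⟨i, hi, h⟩
    obtain ⟨i, hi, h⟩ := this
    refine key _ (o.symm ⟨i, hi⟩) rfl x ?_
    simpa using h

section BergmanAlgebra

variable [Finite X]

instance (P : BergmanPresentation X I) (x : X) : Finite (P.Idx x) := P.finite_idx x

instance (P : BergmanPresentation X I) (c : X →₀ ℕ) : Finite (P.SumIdx c) :=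
  Finite.of_surjective (fun p : (y : MultIndex c) × P.Idx y.elt => (⟨p.1, p.2⟩ : P.SumIdx c))
    fun q => ⟨⟨q.summand, q.idx⟩, rfl⟩

noncomputable instance (P : BergmanPresentation X I) (c : X →₀ ℕ) : Fintype (P.SumIdx c) :=
  Fintype.ofFinite _

/-- The generators of the Bergman algebra: the entries of the matrices `ε_x` for `x ∈ X`, and the
entries of the matrices `σ_i` and `σ'_i` for the red relations `a_i = b_i`. -/
inductive BGen (P : BergmanPresentation X I) : Type _
  | eps (x : X) (p q : P.Idx x) : BGen P
  | sig (i : I) (hi : i ∉ P.blue) (p : P.SumIdx (P.a i)) (q : P.SumIdx (P.b i)) : BGen P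
  | sig' (i : I) (hi : i ∉ P.blue) (p : P.SumIdx (P.b i)) (q : P.SumIdx (P.a i)) : BGen P

section Algebra

variable (K : Type*) [Field K] (P : BergmanPresentation X I)

/-- The only entry of the `1 × 1` matrix `ε_x` of a base generator `x`. -/
noncomputable def epsBase (x : P.base) : FreeAlgebra K P.BGen :=
  FreeAlgebra.ι K (BGen.eps x.1 (Idx.base x.1 x.2) (Idx.base x.1 x.2))

/-- The matrix `ε_x` of a summand `x` of the right hand side of the `i`-th relation (blue), its
rows and columns being indexed like those of `ε_{a_i}`. -/
noncomputable def epsBlue (i : I) (hi : i ∈ P.blue) (x : (P.b i).support) :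
    Matrix (P.SumIdx (P.a i)) (P.SumIdx (P.a i)) (FreeAlgebra K P.BGen) :=
  Matrix.of fun p q => FreeAlgebra.ι K
    (BGen.eps x.1 (Idx.step i hi x.1 x.2 p.summand p.idx)
      (Idx.step i hi x.1 x.2 q.summand q.idx))

open Classical in
/-- The block diagonal matrix `ε_c`. -/
noncomputable def epsSum (c : X →₀ ℕ) :
    Matrix (P.SumIdx c) (P.SumIdx c) (FreeAlgebra K P.BGen) :=
  Matrix.of fun p q =>
    if hpq : q.summand = p.summand then
      FreeAlgebra.ι K (BGen.eps p.summand.elt p.idx (hpq ▸ q.idx))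
    else 0

noncomputable def sigma (i : I) (hi : i ∉ P.blue) :
    Matrix (P.SumIdx (P.a i)) (P.SumIdx (P.b i)) (FreeAlgebra K P.BGen) :=
  Matrix.of fun p q => FreeAlgebra.ι K (BGen.sig i hi p q)

noncomputable def sigma' (i : I) (hi : i ∉ P.blue) :
    Matrix (P.SumIdx (P.b i)) (P.SumIdx (P.a i)) (FreeAlgebra K P.BGen) :=
  Matrix.of fun p q => FreeAlgebra.ι K (BGen.sig' i hi p q)

open Classical in
/-- The defining relations of the Bergman algebra. The first two give `K^{X_base}`; the next two
adjoin, for every blue relation, a universal decomposition of the projective module of `ε_{a_i}`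
into a direct sum indexed by the summands of `b_i`; the others adjoin, for every red relation, a
universal isomorphism between the projective modules of `ε_{a_i}` and `ε_{b_i}`. -/
inductive BRel : FreeAlgebra K P.BGen → FreeAlgebra K P.BGen → Prop
  | base_mul (x y : P.base) :
      BRel (epsBase K P x * epsBase K P y) (if x = y then epsBase K P x else 0)
  | base_sum : BRel (∑ᶠ x : P.base, epsBase K P x) 1
  | blue_mul (i : I) (hi : i ∈ P.blue) (x y : (P.b i).support) (p q : P.SumIdx (P.a i)) :
      BRel ((epsBlue K P i hi x * epsBlue K P i hi y) p q)
        (if x = y then epsBlue K P i hi x p q else 0)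
  | blue_sum (i : I) (hi : i ∈ P.blue) (p q : P.SumIdx (P.a i)) :
      BRel (∑ x : (P.b i).support, epsBlue K P i hi x p q) (epsSum K P (P.a i) p q)
  | red_sigma (i : I) (hi : i ∉ P.blue) (p : P.SumIdx (P.a i)) (q : P.SumIdx (P.b i)) :
      BRel ((epsSum K P (P.a i) * sigma K P i hi * epsSum K P (P.b i)) p q)
        (sigma K P i hi p q)
  | red_sigma' (i : I) (hi : i ∉ P.blue) (p : P.SumIdx (P.b i)) (q : P.SumIdx (P.a i)) :
      BRel ((epsSum K P (P.b i) * sigma' K P i hi * epsSum K P (P.a i)) p q)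
        (sigma' K P i hi p q)
  | red_left (i : I) (hi : i ∉ P.blue) (p q : P.SumIdx (P.a i)) :
      BRel ((sigma K P i hi * sigma' K P i hi) p q) (epsSum K P (P.a i) p q)
  | red_right (i : I) (hi : i ∉ P.blue) (p q : P.SumIdx (P.b i)) :
      BRel ((sigma' K P i hi * sigma K P i hi) p q) (epsSum K P (P.b i) p q)

/-- The Bergman algebra `B(X, R)` of a Bergman presentation. -/
abbrev BergmanAlgebra : Type _ := RingQuot (BRel K P)

end Algebra

end BergmanAlgebra

/-! ### Lonely generator elimination -/

/-- `x` is a lonely generator, and the `i`-th relation is the one of the form `x = b_i`. -/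
structure IsLonely (P : BergmanPresentation X I) (x : X) (i : I) : Prop where
  left_eq : P.a i = Finsupp.single x 1
  right_eq : P.b i x = 0
  other : ∀ j, j ≠ i → P.a j x = 0 ∧ P.b j x = 0

theorem subtypeDomain_ne_zero {x : X} {c : X →₀ ℕ} (hc : c ≠ 0) (hx : c x = 0) :
    c.subtypeDomain (fun y => y ≠ x) ≠ 0 := by
  intro h
  apply hc
  ext y
  by_cases hy : y = x
  · rw [hy, hx]; rfl
  · exact DFunLike.congr_fun h ⟨y, hy⟩

/-- Lonely generator elimination: the lonely generator `x` and the `i`-th relation are removed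
from the basic Bergman presentation `P`. -/
noncomputable def eliminate (P : BergmanPresentation X I) (hP : P.IsBasic) {x : X} {i : I}
    (hx : P.IsLonely x i) : BergmanPresentation {y : X // y ≠ x} {j : I // j ≠ i} where
  a j := (P.a j.1).subtypeDomain (fun y => y ≠ x)
  b j := (P.b j.1).subtypeDomain (fun y => y ≠ x)
  a_ne_zero j := subtypeDomain_ne_zero (P.a_ne_zero j.1) (hx.other j.1 j.2).1
  b_ne_zero j := subtypeDomain_ne_zero (P.b_ne_zero j.1) (hx.other j.1 j.2).2
  blue := {j | j.1 ∈ P.blue}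
  blue_mult j hj := absurd hj (hP.blue_eq j.1)
  blue_card j hj := absurd hj (hP.blue_eq j.1)
  blue_disjoint j hj := absurd hj (hP.blue_eq j.1)
  admissible := by
    have : IsEmpty ({j | j.1 ∈ P.blue} : Set {j : I // j ≠ i}) := ⟨fun j => hP.blue_eq _ j.2⟩
    exact ⟨0, Equiv.equivOfIsEmpty _ _, fun k => k.elim0⟩

end BergmanPresentation

namespace BergmanGraph

variable {V E : Type*}

/-- The set of base vertices. -/
def base (H : BergmanGraph V E) : Set V := {v | ∀ h ∈ H.blue, H.r h v = 0}

/-- A Bergman graph is basic if all its vertices are base vertices. -/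
def IsBasic (H : BergmanGraph V E) : Prop := H.base = Set.univ

theorem IsBasic.blue_eq {H : BergmanGraph V E} (hH : H.IsBasic) (h : E) : h ∉ H.blue := by
  intro hh
  obtain ⟨v, hv⟩ := H.r_nonempty h
  have hb : v ∈ H.base := by rw [hH]; trivial
  exact hv (hb h hh)

/-- The Bergman presentation `β(H)` corresponding to a Bergman graph `H`: the generators are the
vertices, and for every hyperedge `h` there is the relation `∑ s(h) = ∑ r(h)`. -/
noncomputable def toPresentation [Finite V] (H : BergmanGraph V E) :
    BergmanPresentation V E where
  a h := Finsupp.equivFunOnFinite.symm (H.s h)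
  b h := Finsupp.equivFunOnFinite.symm (H.r h)
  a_ne_zero h hz := by
    obtain ⟨v, hv⟩ := H.s_nonempty h
    exact hv (DFunLike.congr_fun hz v)
  b_ne_zero h hz := by
    obtain ⟨v, hv⟩ := H.r_nonempty h
    exact hv (DFunLike.congr_fun hz v)
  blue := H.blue
  blue_mult := H.blue_mult
  blue_card h hh := by
    rw [← Set.ncard_coe_finset, ← Finsupp.fun_support_eq]
    exact H.blue_card h hh
  blue_disjoint h hh g hg hne := by
    rw [← Finset.disjoint_coe, ← Finsupp.fun_support_eq, ← Finsupp.fun_support_eq]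
    exact H.blue_disjoint h hh g hg hne
  admissible := by
    obtain ⟨m, o, ho⟩ := H.admissible
    refine ⟨m, o, fun k v hv => ?_⟩
    rcases ho k v (Finsupp.mem_support_iff.1 hv) with h | ⟨p, hp, h⟩
    · exact Or.inl h
    · exact Or.inr ⟨p, hp, Finsupp.mem_support_iff.2 h⟩

/-- The Bergman algebra `B(H)` of a Bergman graph. -/
abbrev BergmanAlgebra [Finite V] (K : Type*) [Field K] (H : BergmanGraph V E) : Type _ :=
  BergmanPresentation.BergmanAlgebra K H.toPresentation

/-! ### Lonely vertex elimination -/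

/-- `v` is a lonely vertex, and `h` is the hyperedge with `s(h) = {v}`. -/
structure IsLonely (H : BergmanGraph V E) (v : V) (h : E) : Prop where
  source_self : H.s h v = 1
  source_ne : ∀ u, u ≠ v → H.s h u = 0
  not_range : H.r h v = 0
  other : ∀ g, g ≠ h → H.s g v = 0 ∧ H.r g v = 0

/-- Lonely vertex elimination: the lonely vertex `v` and the hyperedge `h` with source `v` are
removed from the basic Bergman graph `H`. -/
def eliminate (H : BergmanGraph V E) (hH : H.IsBasic) {v : V} {h : E} (hv : H.IsLonely v h) :
    BergmanGraph {u : V // u ≠ v} {g : E // g ≠ h} where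
  s g u := H.s g.1 u.1
  r g u := H.r g.1 u.1
  s_nonempty g := by
    obtain ⟨u, hu⟩ := H.s_nonempty g.1
    exact ⟨⟨u, fun e => hu (e ▸ (hv.other g.1 g.2).1)⟩, hu⟩
  r_nonempty g := by
    obtain ⟨u, hu⟩ := H.r_nonempty g.1
    exact ⟨⟨u, fun e => hu (e ▸ (hv.other g.1 g.2).2)⟩, hu⟩
  blue := {g | g.1 ∈ H.blue}
  blue_mult g hg := absurd hg (hH.blue_eq g.1)
  blue_card g hg := absurd hg (hH.blue_eq g.1)
  blue_disjoint g hg := absurd hg (hH.blue_eq g.1)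
  admissible := by
    have : IsEmpty ({g | g.1 ∈ H.blue} : Set {g : E // g ≠ h}) := ⟨fun g => hH.blue_eq _ g.2⟩
    exact ⟨0, Equiv.equivOfIsEmpty _ _, fun k => k.elim0⟩

end BergmanGraph

/-!
Let `e` be the sum of the vertices other than the lonely vertex `v`. Since `v = ∑ⱼ hⱼ hⱼ*` with
`hⱼ ∈ L(H) e`, the idempotent `e` is full, so `L(H)` is Morita equivalent to its corner `e L(H) e`.

The generators of `L(H)` that avoid `v` and `h` satisfy the relations of `L(H')`, which gives a
homomorphism `φ : L(H') → e L(H) e`. It is injective: if `L(H')` is placed in one diagonal entry of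
a matrix algebra over itself, the matrix units that connect this entry with the others serve as
`hⱼ` and `hⱼ*`, so the embedding factors through `φ`. It is surjective: the row
`(e, h₁, h₂, …)` and the column `(e, h₁*, h₂*, …)` have product `1`, so the elements `b` for which
all products `col_p b row_q` lie in the image of `φ` form a subalgebra. This subalgebra contains
all generators of `L(H)`, and `e b e` is one of the products.

The Bergman algebra of a basic presentation has only matrices `ε_x` of size `1 × 1`, and is the
Leavitt path algebra of the hypergraph whose hyperedges are the relations.
-/

/-! ### Corners of algebras -/

section Corner

variable {K A : Type*} [CommSemiring K] [Ring A] [Algebra K A] {e : A}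

instance cornerSMul (he : IsIdempotentElem e) : SMul K he.Corner where
  smul k c := ⟨k • c.1, (Subsemigroup.mem_corner_iff he).2 <| by
    obtain ⟨hl, hr⟩ := (Subsemigroup.mem_corner_iff he).1 c.2
    exact ⟨by rw [mul_smul_comm, hl], by rw [smul_mul_assoc, hr]⟩⟩

instance cornerModule (he : IsIdempotentElem e) : Module K he.Corner :=
  Function.Injective.module K ((NonUnitalRing.corner e).subtype : he.Corner →+ A)
    Subtype.val_injective fun _ _ => rfl

instance cornerAlgebra (he : IsIdempotentElem e) : Algebra K he.Corner :=
  Algebra.ofModule (fun k c d => Subtype.ext (smul_mul_assoc k c.1 d.1))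
    fun k c d => Subtype.ext (mul_smul_comm k c.1 d.1)

variable (K) in
/-- The inclusion of a corner `eAe` into `A`. It is not unital: the unit of `eAe` is `e`. -/
def cornerInclusion (he : IsIdempotentElem e) : he.Corner →ₙₐ[K] A where
  toFun := Subtype.val
  map_smul' _ _ := rfl
  map_zero' := rfl
  map_add' _ _ := rfl
  map_mul' _ _ := rfl

end Corner

/-! ### Morita equivalence of an algebra and its full corners -/

section FullCorner

variable {A : Type*} [Ring A] {e : A}

open scoped Pointwise in
theorem exists_sum_mul_mul_eq_one (hfull : TwoSidedIdeal.span {e} = ⊤) :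
    ∃ (n : ℕ) (x y : Fin n → A), ∑ k, x k * e * y k = 1 := by
  have hone : (1 : A) ∈ Submodule.span ℤ (Set.univ * {e} * Set.univ) := by
    rw [← Submodule.mem_toAddSubgroup, Submodule.span_int_eq_addSubgroupClosure,
      ← TwoSidedIdeal.mem_span_iff_mem_addSubgroup_closure, hfull]
    exact TwoSidedIdeal.mem_top A
  obtain ⟨n, c, g, hsum⟩ := Submodule.mem_span_set'.1 hone
  have hg (k : Fin n) : ∃ x y, x * e * y = (g k : A) := by
    obtain ⟨_, ⟨x, -, _, rfl, rfl⟩, y, -, hxy⟩ := (g k).2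
    exact ⟨x, y, hxy⟩
  choose x y hxy using hg
  exact ⟨n, fun k => c k • x k, y, by simpa only [smul_mul_assoc, hxy] using hsum⟩

section CornerPart

variable {M N : Type*} [AddCommGroup M] [Module A M] [AddCommGroup N] [Module A N]

variable (e M) in
/-- The subgroup `eM` of an `A`-module `M`, on which the corner `eAe` of an idempotent `e` acts. -/
def cornerPart : AddSubgroup M where
  carrier := {m | e • m = m}
  zero_mem' := smul_zero e
  add_mem' {m n} hm hn := (smul_add e m n).trans (congrArg₂ (· + ·) hm hn)
  neg_mem' {m} hm := (smul_neg e m).trans (congrArg Neg.neg hm)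

theorem mem_cornerPart {m : M} : m ∈ cornerPart e M ↔ e • m = m := Iff.rfl

theorem smul_cornerPart (m : cornerPart e M) : e • m.1 = m.1 := m.2

instance moduleCornerPart (he : IsIdempotentElem e) : Module he.Corner (cornerPart e M) where
  smul c m := ⟨c.1 • m.1, by
    rw [mem_cornerPart, ← mul_smul, ((Subsemigroup.mem_corner_iff he).1 c.2).1]⟩
  one_smul m := Subtype.ext m.2
  mul_smul c d m := Subtype.ext (mul_smul c.1 d.1 m.1)
  smul_zero c := Subtype.ext (smul_zero c.1)
  smul_add c m n := Subtype.ext (smul_add c.1 m.1 n.1)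
  add_smul c d m := Subtype.ext (add_smul c.1 d.1 m.1)
  zero_smul m := Subtype.ext (zero_smul A m.1)

theorem coe_smul_cornerPart (he : IsIdempotentElem e) (c : he.Corner) (m : cornerPart e M) :
    (c • m).1 = c.1 • m.1 := rfl

variable (M) in
/-- The projection `m ↦ em` of a module `M` onto `eM`. -/
def cornerProj (he : IsIdempotentElem e) : M →+ cornerPart e M where
  toFun m := ⟨e • m, by rw [mem_cornerPart, ← mul_smul, he.eq]⟩
  map_zero' := Subtype.ext (smul_zero e)
  map_add' m n := Subtype.ext (smul_add e m n)

theorem coe_cornerProj (he : IsIdempotentElem e) (m : M) : (cornerProj M he m).1 = e • m := rfl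

theorem sum_smul_smul_smul {ι : Type*} [Fintype ι] {x y : ι → A}
    (hxy : ∑ k, x k * e * y k = 1) (m : M) : ∑ k, x k • e • y k • m = m := by
  simp_rw [← mul_smul, ← Finset.sum_smul, ← mul_assoc, hxy, one_smul]

theorem eq_of_forall_smul_smul_eq (hfull : TwoSidedIdeal.span {e} = ⊤) {m n : M}
    (h : ∀ a : A, e • a • m = e • a • n) : m = n := by
  obtain ⟨_, x, y, hxy⟩ := exists_sum_mul_mul_eq_one hfull
  rw [← sum_smul_smul_smul hxy m, ← sum_smul_smul_smul hxy n]
  simp only [h]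

/-- The `eAe`-linear map `eM → eN` obtained by restricting an `A`-linear map `M → N`. -/
def cornerPartMap (he : IsIdempotentElem e) (f : M →ₗ[A] N) :
    cornerPart e M →ₗ[he.Corner] cornerPart e N where
  toFun m := ⟨f m.1, by rw [mem_cornerPart, ← map_smul, smul_cornerPart]⟩
  map_add' m n := Subtype.ext (map_add f m.1 n.1)
  map_smul' c m := Subtype.ext (map_smul f c.1 m.1)

theorem cornerPartMap_injective (he : IsIdempotentElem e)
    (hfull : TwoSidedIdeal.span {e} = ⊤) :
    Function.Injective
      (cornerPartMap he : (M →ₗ[A] N) → cornerPart e M →ₗ[he.Corner] cornerPart e N) := by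
  intro f g hfg
  ext m
  refine eq_of_forall_smul_smul_eq hfull fun a => ?_
  have hproj : f (e • a • m) = g (e • a • m) :=
    congrArg Subtype.val (LinearMap.congr_fun hfg (cornerProj M he (a • m)))
  rwa [map_smul, map_smul, map_smul, map_smul] at hproj

theorem smul_smul_coe_cornerPart_map (he : IsIdempotentElem e)
    (g : cornerPart e M →ₗ[he.Corner] cornerPart e N) (a : A) (m : cornerPart e M) :
    e • a • (g m).1 = (g (cornerProj M he (a • m.1))).1 := by
  let c : he.Corner := ⟨e * a * e, a, rfl⟩
  have hproj : cornerProj M he (a • m.1) = c • m := Subtype.ext <| by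
    rw [coe_cornerProj, coe_smul_cornerPart, mul_smul, mul_smul, smul_cornerPart]
  rw [hproj, map_smul, coe_smul_cornerPart, mul_smul, mul_smul, smul_cornerPart]

theorem cornerPartMap_surjective (he : IsIdempotentElem e)
    (hfull : TwoSidedIdeal.span {e} = ⊤) :
    Function.Surjective
      (cornerPartMap he : (M →ₗ[A] N) → cornerPart e M →ₗ[he.Corner] cornerPart e N) := by
  intro g
  obtain ⟨_, x, y, hxy⟩ := exists_sum_mul_mul_eq_one hfull
  let f (m : M) : N := ∑ k, x k • (g (cornerProj M he (y k • m))).1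
  have smul_smul_f (a : A) (m : M) : e • a • f m = (g (cornerProj M he (a • m))).1 := calc
    e • a • f m = ∑ k, e • (a * x k) • (g (cornerProj M he (y k • m))).1 := by
      simp only [f, Finset.smul_sum, mul_smul]
    _ = (g (cornerProj M he (∑ k, (a * x k) • e • y k • m))).1 := by
      simp only [smul_smul_coe_cornerPart_map, coe_cornerProj, map_sum,
        AddSubgroup.val_finsetSum]
    _ = (g (cornerProj M he (a • m))).1 := by
      simp only [mul_smul, ← Finset.smul_sum, sum_smul_smul_smul hxy]
  let fₗ : M →ₗ[A] N :=
    { toFun := f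
      map_add' m n := eq_of_forall_smul_smul_eq hfull fun a => by
        simp only [smul_add, smul_smul_f, map_add, AddSubgroup.coe_add]
      map_smul' b m := eq_of_forall_smul_smul_eq hfull fun a => by
        simp only [RingHom.id_apply, smul_smul_f, ← mul_smul a] }
  refine ⟨fₗ, LinearMap.ext fun m => Subtype.ext <| eq_of_forall_smul_smul_eq hfull fun a => ?_⟩
  exact (smul_smul_f a m.1).trans (smul_smul_coe_cornerPart_map he g a m).symm

end CornerPart

section Coinduced

variable (he : IsIdempotentElem e)

/-- The right multiplication by an element of `A` on the left `eAe`-module `eA`. -/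
def cornerPartMulRight (a : A) : cornerPart e A →ₗ[he.Corner] cornerPart e A :=
  cornerPartMap he (LinearMap.toSpanSingleton A A a)

variable (N : Type*) [AddCommGroup N] [Module he.Corner N]

/-- The `A`-module `Hom_{eAe}(eA, N)` coinduced from an `eAe`-module `N`; `A` acts on it through
the right multiplication on `eA`. -/
def CornerCoinduced : Type _ := cornerPart e A →ₗ[he.Corner] N

instance : AddCommGroup (CornerCoinduced he N) :=
  inferInstanceAs (AddCommGroup (cornerPart e A →ₗ[he.Corner] N))

instance : FunLike (CornerCoinduced he N) (cornerPart e A) N :=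
  inferInstanceAs (FunLike (cornerPart e A →ₗ[he.Corner] N) (cornerPart e A) N)

instance : LinearMapClass (CornerCoinduced he N) he.Corner (cornerPart e A) N :=
  inferInstanceAs
    (LinearMapClass (cornerPart e A →ₗ[he.Corner] N) he.Corner (cornerPart e A) N)

instance : Module A (CornerCoinduced he N) where
  smul a f := LinearMap.comp f (cornerPartMulRight he a)
  one_smul f := LinearMap.ext fun x => congrArg f (Subtype.ext (mul_one x.1))
  mul_smul a b f := LinearMap.ext fun x => congrArg f (Subtype.ext (mul_assoc x.1 a b).symm)
  smul_zero _ := rfl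
  smul_add _ _ _ := rfl
  add_smul a b f := LinearMap.ext fun x =>
    (congrArg f (Subtype.ext (mul_add x.1 a b))).trans (map_add f _ _)
  zero_smul f := LinearMap.ext fun x =>
    (congrArg f (Subtype.ext (mul_zero x.1))).trans (map_zero f)

/-- The `eAe`-linear map `eA → eAe`, `x ↦ xe`. -/
def cornerPartToCorner : cornerPart e A →ₗ[he.Corner] he.Corner where
  toFun x := ⟨x.1 * e, (Subsemigroup.mem_corner_iff he).2
    ⟨(mul_assoc e x.1 e).symm.trans (congrArg (· * e) x.2), by rw [mul_assoc, he.eq]⟩⟩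
  map_add' x y := Subtype.ext (add_mul x.1 y.1 e)
  map_smul' c x := Subtype.ext (mul_assoc c.1 x.1 e)

theorem cornerPartToCorner_cornerProj_one : cornerPartToCorner he (cornerProj A he 1) = 1 :=
  Subtype.ext (show e * 1 * e = e by rw [mul_one, he.eq])

theorem cornerPartToCorner_mulRight (x : cornerPart e A) :
    cornerPartToCorner he (cornerPartMulRight he e x) = cornerPartToCorner he x :=
  Subtype.ext (show x.1 * e * e = x.1 * e by rw [mul_assoc, he.eq])

theorem cornerPartToCorner_smul_cornerProj_one (x : cornerPart e A) :
    cornerPartToCorner he x • cornerProj A he 1 = cornerPartMulRight he e x :=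
  Subtype.ext (show x.1 * e * (e * 1) = x.1 * e by rw [mul_one, mul_assoc, he.eq])

theorem cornerPartMulRight_cornerProj_one (c : he.Corner) :
    cornerPartMulRight he c.1 (cornerProj A he 1) = c • cornerProj A he 1 :=
  Subtype.ext (show e * 1 * c.1 = c.1 * (e * 1) by
    obtain ⟨hl, hr⟩ := (Subsemigroup.mem_corner_iff he).1 c.2
    rw [mul_one, hl, hr])

/-- The isomorphism `e Hom_{eAe}(eA, N) ≅ N` of `eAe`-modules, given by the evaluation at `e`. -/
def cornerPartCoinducedEquiv : cornerPart e (CornerCoinduced he N) ≃ₗ[he.Corner] N where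
  toFun f := f.1 (cornerProj A he 1)
  map_add' _ _ := rfl
  map_smul' c f := (congrArg f.1 (cornerPartMulRight_cornerProj_one he c)).trans
    (map_smul f.1 c _)
  invFun n := ⟨(cornerPartToCorner he).smulRight n,
    LinearMap.ext fun x => congrArg (· • n) (cornerPartToCorner_mulRight he x)⟩
  left_inv f := Subtype.ext <| LinearMap.ext fun x => calc
    cornerPartToCorner he x • f.1 (cornerProj A he 1)
    _ = f.1 (cornerPartToCorner he x • cornerProj A he 1) :=
      (map_smul f.1 _ _).symm
    _ = f.1 (cornerPartMulRight he e x) := by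
      rw [cornerPartToCorner_smul_cornerProj_one]
    _ = f.1 x := LinearMap.congr_fun (smul_cornerPart f) x
  right_inv n := (congrArg (· • n) (cornerPartToCorner_cornerProj_one he)).trans (one_smul _ n)

end Coinduced

end FullCorner

section Functor

universe u v

open CategoryTheory

variable {A : Type u} [Ring A] {e : A} (he : IsIdempotentElem e)

/-- The functor that maps an `A`-module `M` to the `eAe`-module `eM`. -/
def cornerFunctor : ModuleCat.{v} A ⥤ ModuleCat.{v} he.Corner where
  obj M := ModuleCat.of he.Corner (cornerPart e M)
  map f := ModuleCat.ofHom (cornerPartMap he f.hom)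

theorem isEquivalence_cornerFunctor (hfull : TwoSidedIdeal.span {e} = ⊤) :
    (cornerFunctor.{u, max u v} he).IsEquivalence where
  faithful :=
    ⟨fun h => ModuleCat.hom_ext (cornerPartMap_injective he hfull (ModuleCat.hom_ext_iff.1 h))⟩
  full := ⟨fun g =>
    let ⟨f, hf⟩ := cornerPartMap_surjective he hfull g.hom
    ⟨ModuleCat.ofHom f, ModuleCat.hom_ext hf⟩⟩
  essSurj := ⟨fun N => ⟨ModuleCat.of A (CornerCoinduced he N),
    ⟨(cornerPartCoinducedEquiv he N).toModuleIso⟩⟩⟩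

variable {K : Type*} [CommSemiring K] [Algebra K A]

open scoped ModuleCat.Algebra in
instance : (cornerFunctor.{u, v} he).Linear K where
  map_smul {M N} f k := ModuleCat.hom_ext <| LinearMap.ext fun m => Subtype.ext <| calc
    algebraMap K A k • f.hom m.1 = algebraMap K A k • e • f.hom m.1 :=
      congrArg (algebraMap K A k • ·) (smul_cornerPart (cornerPartMap he f.hom m)).symm
    _ = (algebraMap K he.Corner k).1 • f.hom m.1 := by
      rw [← mul_smul, ← Algebra.smul_def, Algebra.algebraMap_eq_smul_one]
      rfl

end Functor

open scoped ModuleCat.Algebra in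
theorem isMoritaEquivalent_corner (K : Type*) [CommSemiring K] {A : Type*} [Ring A] [Algebra K A]
    {e : A} (he : IsIdempotentElem e) (hfull : TwoSidedIdeal.span {e} = ⊤) :
    IsMoritaEquivalent K he.Corner A := by
  have := isEquivalence_cornerFunctor he hfull
  refine IsMoritaEquivalent.symm K ⟨⟨⟨(cornerFunctor he).asEquivalence, ?_⟩⟩⟩
  exact inferInstanceAs ((cornerFunctor he).Linear K)

/-! ### The universal property of Leavitt path algebras -/

namespace OrientedHypergraph

section LeavittFamily

variable {V E : Type*} [Finite V] {H : OrientedHypergraph V E}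

open Classical in
/-- A family of elements of a nonunital ring that satisfies the defining relations of the Leavitt
path algebra of `H`, except possibly for the relation `sum_vert`. -/
structure LeavittFamily (H : OrientedHypergraph V E) (A : Type*) [NonUnitalSemiring A] where
  vert : V → A
  edge : ∀ h, MultIndex (H.s h) → MultIndex (H.r h) → A
  ghost : ∀ h, MultIndex (H.s h) → MultIndex (H.r h) → A
  vert_mul : ∀ u v, vert u * vert v = if u = v then vert u else 0
  vert_edge : ∀ h i j, vert i.elt * edge h i j = edge h i j
  edge_vert : ∀ h i j, edge h i j * vert j.elt = edge h i j
  vert_ghost : ∀ h i j, vert j.elt * ghost h i j = ghost h i j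
  ghost_vert : ∀ h i j, ghost h i j * vert i.elt = ghost h i j
  edge_ghost : ∀ h i i', ∑ j, edge h i j * ghost h i' j = if i = i' then vert i.elt else 0
  ghost_edge : ∀ h j j', ∑ i, ghost h i j * edge h i j' = if j = j' then vert j.elt else 0

namespace LeavittFamily

section NonUnital

variable {A B : Type*} [NonUnitalSemiring A] [NonUnitalSemiring B] (F : LeavittFamily H A)

/-- The member of a Leavitt family that corresponds to a generator of the Leavitt path algebra. -/
def gen : H.LGen → A
  | .vert v => F.vert v
  | .edge h i j => F.edge h i j
  | .ghost h i j => F.ghost h i j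

/-- The image of a Leavitt family under a homomorphism. -/
def map (f : A →ₙ+* B) : LeavittFamily H B where
  vert v := f (F.vert v)
  edge h i j := f (F.edge h i j)
  ghost h i j := f (F.ghost h i j)
  vert_mul u v := by rw [← map_mul, F.vert_mul, apply_ite f, map_zero]
  vert_edge h i j := by rw [← map_mul, F.vert_edge]
  edge_vert h i j := by rw [← map_mul, F.edge_vert]
  vert_ghost h i j := by rw [← map_mul, F.vert_ghost]
  ghost_vert h i j := by rw [← map_mul, F.ghost_vert]
  edge_ghost h i i' := by simp_rw [← map_mul, ← map_sum, F.edge_ghost, apply_ite f, map_zero]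
  ghost_edge h j j' := by simp_rw [← map_mul, ← map_sum, F.ghost_edge, apply_ite f, map_zero]

/-- The Leavitt family formed by preimages `b g` of the members of a Leavitt family under an
injective homomorphism. -/
def comap (f : B →ₙ+* A) (hf : Function.Injective f) (b : H.LGen → B)
    (hb : ∀ g, f (b g) = F.gen g) : LeavittFamily H B where
  vert v := b (.vert v)
  edge h i j := b (.edge h i j)
  ghost h i j := b (.ghost h i j)
  vert_mul u v := hf <| by simp only [map_mul, apply_ite f, map_zero, hb, gen, F.vert_mul]
  vert_edge h i j := hf <| by simp only [map_mul, hb, gen, F.vert_edge]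
  edge_vert h i j := hf <| by simp only [map_mul, hb, gen, F.edge_vert]
  vert_ghost h i j := hf <| by simp only [map_mul, hb, gen, F.vert_ghost]
  ghost_vert h i j := hf <| by simp only [map_mul, hb, gen, F.ghost_vert]
  edge_ghost h i i' := hf <| by
    simp only [map_sum, map_mul, apply_ite f, map_zero, hb, gen, F.edge_ghost]
  ghost_edge h j j' := hf <| by
    simp only [map_sum, map_mul, apply_ite f, map_zero, hb, gen, F.ghost_edge]

/-- The sum of the vertices of a Leavitt family, which is a unit for all of its members. -/
noncomputable def unit : A := ∑ᶠ v, F.vert v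

theorem unit_eq_sum [Fintype V] : F.unit = ∑ v, F.vert v := finsum_eq_sum_of_fintype _

theorem vert_mul_self (v : V) : F.vert v * F.vert v = F.vert v := by
  rw [F.vert_mul, if_pos rfl]

theorem unit_mul_vert (v : V) : F.unit * F.vert v = F.vert v := by
  classical
  have := Fintype.ofFinite V
  simp only [unit_eq_sum, Finset.sum_mul, F.vert_mul, Finset.sum_ite_eq', Finset.mem_univ, if_true]

theorem vert_mul_unit (v : V) : F.vert v * F.unit = F.vert v := by
  classical
  have := Fintype.ofFinite V
  simp only [unit_eq_sum, Finset.mul_sum, F.vert_mul, Finset.sum_ite_eq, Finset.mem_univ, if_true]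

theorem unit_mul_gen (g : H.LGen) : F.unit * F.gen g = F.gen g := by
  cases g with
  | vert v => exact F.unit_mul_vert v
  | edge h i j => rw [gen, ← F.vert_edge, ← mul_assoc, F.unit_mul_vert]
  | ghost h i j => rw [gen, ← F.vert_ghost, ← mul_assoc, F.unit_mul_vert]

theorem gen_mul_unit (g : H.LGen) : F.gen g * F.unit = F.gen g := by
  cases g with
  | vert v => exact F.vert_mul_unit v
  | edge h i j => rw [gen, ← F.edge_vert, mul_assoc, F.vert_mul_unit]
  | ghost h i j => rw [gen, ← F.ghost_vert, mul_assoc, F.vert_mul_unit]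

theorem isIdempotentElem_unit : IsIdempotentElem F.unit := by
  have := Fintype.ofFinite V
  change F.unit * F.unit = F.unit
  nth_rw 2 [unit_eq_sum]
  rw [Finset.mul_sum, unit_eq_sum]
  exact Finset.sum_congr rfl fun v _ => by rw [← unit_eq_sum, unit_mul_vert]

end NonUnital

variable (K : Type*) [Field K] {A : Type*}

section Unital

variable [Semiring A] [Algebra K A] (F : LeavittFamily H A)

theorem freeLift_eq_of_rel (hF : F.unit = 1) {a b : FreeAlgebra K H.LGen} (hab : LRel K H a b) :
    FreeAlgebra.lift K F.gen a = FreeAlgebra.lift K F.gen b := by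
  classical
  have := Fintype.ofFinite V
  induction hab <;>
    simp only [preVert, preEdge, preGhost, map_mul, map_sum, map_zero, map_one,
      apply_ite (FreeAlgebra.lift K F.gen), FreeAlgebra.lift_ι_apply, gen,
      finsum_eq_sum_of_fintype, ← unit_eq_sum, hF, F.vert_mul, F.vert_edge, F.edge_vert,
      F.vert_ghost, F.ghost_vert, F.edge_ghost, F.ghost_edge]

/-- The homomorphism of algebras on the Leavitt path algebra that is induced by a Leavitt family
with unit `1`. -/
noncomputable def liftUnital (hF : F.unit = 1) : LeavittPathAlgebra K H →ₐ[K] A :=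
  RingQuot.liftAlgHom K ⟨FreeAlgebra.lift K F.gen, fun _ _ => F.freeLift_eq_of_rel K hF⟩

end Unital

section Lift

variable [Ring A] [Algebra K A] (F : LeavittFamily H A)

/-- A Leavitt family as a family in the corner of its unit. -/
noncomputable def toCorner : LeavittFamily H F.isIdempotentElem_unit.Corner :=
  F.comap (cornerInclusion ℕ F.isIdempotentElem_unit) Subtype.val_injective
    (fun g => ⟨F.gen g, (Subsemigroup.mem_corner_iff F.isIdempotentElem_unit).2
      ⟨F.unit_mul_gen g, F.gen_mul_unit g⟩⟩) fun _ => rfl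

theorem unit_toCorner : F.toCorner.unit = 1 := Subtype.ext <| by
  have := Fintype.ofFinite V
  exact (congrArg Subtype.val F.toCorner.unit_eq_sum).trans <|
    (map_sum (cornerInclusion ℕ _) _ _).trans F.unit_eq_sum.symm

/-- The homomorphism of algebras from the Leavitt path algebra to the corner of the unit of a
Leavitt family. -/
noncomputable def liftCorner : LeavittPathAlgebra K H →ₐ[K] F.isIdempotentElem_unit.Corner :=
  F.toCorner.liftUnital K F.unit_toCorner

/-- The homomorphism of nonunital algebras on the Leavitt path algebra that is induced by a
Leavitt family. -/
noncomputable def lift : LeavittPathAlgebra K H →ₙₐ[K] A :=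
  (cornerInclusion K F.isIdempotentElem_unit).comp (F.liftCorner K : _ →ₙₐ[K] _)

end Lift

end LeavittFamily

end LeavittFamily

section Universal

variable {V E : Type*} [Finite V] (K : Type*) [Field K] (H : OrientedHypergraph V E)

/-- The Leavitt family formed by the generators of the Leavitt path algebra. -/
noncomputable def leavittFamily : LeavittFamily H (LeavittPathAlgebra K H) where
  vert v := RingQuot.mkAlgHom K (LRel K H) (preVert K H v)
  edge h i j := RingQuot.mkAlgHom K (LRel K H) (preEdge K H h i j)
  ghost h i j := RingQuot.mkAlgHom K (LRel K H) (preGhost K H h i j)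
  vert_mul u v := by
    simpa only [map_mul, map_zero, apply_ite (RingQuot.mkAlgHom K (LRel K H))] using
      RingQuot.mkAlgHom_rel K (LRel.vert_mul (K := K) (H := H) u v)
  vert_edge h i j := by
    rw [← map_mul, RingQuot.mkAlgHom_rel K (LRel.vert_edge h i j)]
  edge_vert h i j := by
    rw [← map_mul, RingQuot.mkAlgHom_rel K (LRel.edge_vert h i j)]
  vert_ghost h i j := by
    rw [← map_mul, RingQuot.mkAlgHom_rel K (LRel.vert_ghost h i j)]
  ghost_vert h i j := by
    rw [← map_mul, RingQuot.mkAlgHom_rel K (LRel.ghost_vert h i j)]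
  edge_ghost h i i' := by
    simpa only [map_mul, map_sum, map_zero, apply_ite (RingQuot.mkAlgHom K (LRel K H))] using
      RingQuot.mkAlgHom_rel K (LRel.edge_ghost (K := K) (H := H) h i i')
  ghost_edge h j j' := by
    simpa only [map_mul, map_sum, map_zero, apply_ite (RingQuot.mkAlgHom K (LRel K H))] using
      RingQuot.mkAlgHom_rel K (LRel.ghost_edge (K := K) (H := H) h j j')

theorem gen_leavittFamily (g : H.LGen) :
    (H.leavittFamily K).gen g = RingQuot.mkAlgHom K (LRel K H) (FreeAlgebra.ι K g) := by
  cases g <;> rfl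

theorem unit_leavittFamily : (H.leavittFamily K).unit = 1 := by
  have := Fintype.ofFinite V
  have hrel := RingQuot.mkAlgHom_rel K (LRel.sum_vert (K := K) (H := H))
  rw [finsum_eq_sum_of_fintype, map_sum, map_one] at hrel
  exact (LeavittFamily.unit_eq_sum _).trans hrel

theorem adjoin_range_gen_leavittFamily :
    NonUnitalAlgebra.adjoin K (Set.range (H.leavittFamily K).gen) = ⊤ := by
  have := Fintype.ofFinite V
  have gen_mem (g : H.LGen) : (H.leavittFamily K).gen g ∈
      NonUnitalAlgebra.adjoin K (Set.range (H.leavittFamily K).gen) :=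
    NonUnitalAlgebra.subset_adjoin K ⟨g, rfl⟩
  refine NonUnitalAlgebra.eq_top_iff.2 fun a => ?_
  obtain ⟨a, rfl⟩ := RingQuot.mkAlgHom_surjective K (LRel K H) a
  induction a using FreeAlgebra.induction with
  | grade0 k =>
    rw [AlgHom.commutes, Algebra.algebraMap_eq_smul_one, ← unit_leavittFamily,
      LeavittFamily.unit_eq_sum]
    exact SMulMemClass.smul_mem k (sum_mem fun v _ => gen_mem (.vert v))
  | grade1 g => exact gen_leavittFamily K H g ▸ gen_mem g
  | mul a b ha hb => rw [map_mul]; exact mul_mem ha hb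
  | add a b ha hb => rw [map_add]; exact add_mem ha hb

variable {K H}

namespace LeavittFamily

theorem liftUnital_gen {A : Type*} [Semiring A] [Algebra K A] (F : LeavittFamily H A)
    (hF : F.unit = 1) (g : H.LGen) :
    F.liftUnital K hF ((H.leavittFamily K).gen g) = F.gen g := by
  rw [liftUnital, gen_leavittFamily, RingQuot.liftAlgHom_mkAlgHom_apply, FreeAlgebra.lift_ι_apply]

theorem lift_gen {A : Type*} [Ring A] [Algebra K A] (F : LeavittFamily H A) (g : H.LGen) :
    F.lift K ((H.leavittFamily K).gen g) = F.gen g := by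
  refine (congrArg Subtype.val (F.toCorner.liftUnital_gen F.unit_toCorner g)).trans ?_
  cases g <;> rfl

end LeavittFamily

theorem leavitt_nonUnitalAlgHom_ext {A : Type*} [NonUnitalSemiring A] [Module K A]
    [IsScalarTower K A A] [SMulCommClass K A A] {f f' : LeavittPathAlgebra K H →ₙₐ[K] A}
    (hgen : ∀ g, f ((H.leavittFamily K).gen g) = f' ((H.leavittFamily K).gen g)) : f = f' := by
  have hle : NonUnitalAlgebra.adjoin K (Set.range (H.leavittFamily K).gen) ≤
      NonUnitalAlgHom.equalizer f f' :=
    NonUnitalAlgebra.adjoin_le <| Set.range_subset_iff.2 hgen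
  rw [adjoin_range_gen_leavittFamily] at hle
  exact NonUnitalAlgHom.ext fun a => hle (NonUnitalAlgebra.mem_top (x := a))

end Universal

end OrientedHypergraph

/-! ### Elimination of a lonely vertex -/

namespace MultIndex

variable {V : Type*} {m : V → ℕ}

theorem mult_ne_zero (i : MultIndex m) : m i.elt ≠ 0 := (Fin.pos i.occ).ne'

theorem elt_ne {v : V} (hm : m v = 0) (i : MultIndex m) : i.elt ≠ v :=
  fun hi => i.mult_ne_zero (hi ▸ hm)

/-- The occurrences of elements in a multiset that does not contain `v`, as occurrences in its
restriction to the elements other than `v`. -/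
def restrict {v : V} (hm : m v = 0) :
    MultIndex m ≃ MultIndex fun u : {u : V // u ≠ v} => m u.1 where
  toFun i := ⟨⟨i.elt, i.elt_ne hm⟩, i.occ⟩
  invFun i := ⟨i.elt.1, i.occ⟩
  left_inv _ := rfl
  right_inv _ := rfl

end MultIndex

namespace OrientedHypergraph

section Eliminate

variable {V E : Type*}

/-- `v` is a lonely vertex of a hypergraph, and `h` is the hyperedge with `s(h) = {v}`. -/
structure IsLonely (H : OrientedHypergraph V E) (v : V) (h : E) : Prop where
  source_self : H.s h v = 1
  source_ne : ∀ u, u ≠ v → H.s h u = 0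
  not_range : H.r h v = 0
  other : ∀ g, g ≠ h → H.s g v = 0 ∧ H.r g v = 0

/-- The hypergraph obtained by removing a lonely vertex and the hyperedge starting at it. -/
def eliminate (H : OrientedHypergraph V E) {v : V} {h : E} (hv : H.IsLonely v h) :
    OrientedHypergraph {u : V // u ≠ v} {g : E // g ≠ h} where
  s g u := H.s g.1 u.1
  r g u := H.r g.1 u.1
  s_nonempty g := by
    obtain ⟨u, hu⟩ := H.s_nonempty g.1
    exact ⟨⟨u, fun e => hu (e ▸ (hv.other g.1 g.2).1)⟩, hu⟩
  r_nonempty g := by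
    obtain ⟨u, hu⟩ := H.r_nonempty g.1
    exact ⟨⟨u, fun e => hu (e ▸ (hv.other g.1 g.2).2)⟩, hu⟩

variable {H : OrientedHypergraph V E} {v : V} {h : E}

namespace IsLonely

variable (hv : H.IsLonely v h)

include hv in
theorem source_elt_eq (i : MultIndex (H.s h)) : i.elt = v :=
  by_contra fun hne => i.mult_ne_zero (hv.source_ne _ hne)

/-- The source of the hyperedge that starts at a lonely vertex. -/
def source : MultIndex (H.s h) := ⟨v, ⟨0, by rw [hv.source_self]; exact one_pos⟩⟩

theorem eq_source (i : MultIndex (H.s h)) : i = hv.source := by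
  obtain ⟨u, k⟩ := i
  obtain rfl : u = v := hv.source_elt_eq ⟨u, k⟩
  have : Subsingleton (Fin (H.s h u)) := Fin.subsingleton_iff_le_one.2 hv.source_self.le
  exact congrArg (MultIndex.mk u) (Subsingleton.elim _ _)

theorem sum_source {A : Type*} [Finite V] [AddCommMonoid A] (f : MultIndex (H.s h) → A) :
    ∑ i, f i = f hv.source :=
  Fintype.sum_eq_single _ fun i hi => absurd (hv.eq_source i) hi

/-- A range of the hyperedge starting at a lonely vertex `v`, as a vertex other than `v`. -/
def rangeVert (j : MultIndex (H.r h)) : {u : V // u ≠ v} := ⟨j.elt, j.elt_ne hv.not_range⟩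

/-- The sources of a hyperedge that remains when a lonely vertex is eliminated. -/
def sourceEquiv (g : {g : E // g ≠ h}) :
    MultIndex (H.s g.1) ≃ MultIndex ((H.eliminate hv).s g) :=
  MultIndex.restrict (hv.other g.1 g.2).1

/-- The ranges of a hyperedge that remains when a lonely vertex is eliminated. -/
def rangeEquiv (g : {g : E // g ≠ h}) :
    MultIndex (H.r g.1) ≃ MultIndex ((H.eliminate hv).r g) :=
  MultIndex.restrict (hv.other g.1 g.2).2

theorem sourceEquiv_symm_elt (g : {g : E // g ≠ h}) (i : MultIndex ((H.eliminate hv).s g)) :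
    ((hv.sourceEquiv g).symm i).elt = i.elt.1 := rfl

theorem rangeEquiv_symm_elt (g : {g : E // g ≠ h}) (j : MultIndex ((H.eliminate hv).r g)) :
    ((hv.rangeEquiv g).symm j).elt = j.elt.1 := rfl

/-- A generator of `L(H')` as a generator of `L(H)`, where `H'` is obtained from `H` by eliminating
a lonely vertex. -/
def liftGen : (H.eliminate hv).LGen → H.LGen
  | .vert u => .vert u.1
  | .edge g i j => .edge g.1 ((hv.sourceEquiv g).symm i) ((hv.rangeEquiv g).symm j)
  | .ghost g i j => .ghost g.1 ((hv.sourceEquiv g).symm i) ((hv.rangeEquiv g).symm j)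

end IsLonely

end Eliminate

namespace LeavittFamily

variable {V E : Type*} [Finite V] {H : OrientedHypergraph V E} {v : V} {h : E}
  {A : Type*} [NonUnitalSemiring A] (hv : H.IsLonely v h)

open Classical in
/-- The restriction of a Leavitt family to the hypergraph obtained by eliminating a lonely
vertex. -/
def restrict (F : LeavittFamily H A) : LeavittFamily (H.eliminate hv) A where
  vert u := F.vert u.1
  edge g i j := F.edge g.1 ((hv.sourceEquiv g).symm i) ((hv.rangeEquiv g).symm j)
  ghost g i j := F.ghost g.1 ((hv.sourceEquiv g).symm i) ((hv.rangeEquiv g).symm j)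
  vert_mul u w := by simpa only [Subtype.ext_iff] using F.vert_mul u.1 w.1
  vert_edge g i j := F.vert_edge g.1 ((hv.sourceEquiv g).symm i) ((hv.rangeEquiv g).symm j)
  edge_vert g i j := F.edge_vert g.1 ((hv.sourceEquiv g).symm i) ((hv.rangeEquiv g).symm j)
  vert_ghost g i j := F.vert_ghost g.1 ((hv.sourceEquiv g).symm i) ((hv.rangeEquiv g).symm j)
  ghost_vert g i j := F.ghost_vert g.1 ((hv.sourceEquiv g).symm i) ((hv.rangeEquiv g).symm j)
  edge_ghost g i i' := by
    rw [Equiv.sum_comp (hv.rangeEquiv g).symm fun j =>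
      F.edge g.1 ((hv.sourceEquiv g).symm i) j * F.ghost g.1 ((hv.sourceEquiv g).symm i') j,
      F.edge_ghost]
    simp only [EmbeddingLike.apply_eq_iff_eq, hv.sourceEquiv_symm_elt]
  ghost_edge g j j' := by
    rw [Equiv.sum_comp (hv.sourceEquiv g).symm fun i =>
      F.ghost g.1 i ((hv.rangeEquiv g).symm j) * F.edge g.1 i ((hv.rangeEquiv g).symm j'),
      F.ghost_edge]
    simp only [EmbeddingLike.apply_eq_iff_eq, hv.rangeEquiv_symm_elt]

theorem gen_restrict (F : LeavittFamily H A) (g : (H.eliminate hv).LGen) :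
    (F.restrict hv).gen g = F.gen (hv.liftGen g) := by
  cases g <;> rfl

variable {hv}

open Classical in
/-- Elements `h_j` and `h_j^*` by which a Leavitt family of the hypergraph without the lonely vertex
`v` and its hyperedge `h` is extended to one of the original hypergraph; `v` is then mapped to
`∑_j h_j h_j^*`. -/
structure LonelyEdge (F : LeavittFamily (H.eliminate hv) A) where
  edge : MultIndex (H.r h) → A
  ghost : MultIndex (H.r h) → A
  edge_vert : ∀ j, edge j * F.vert (hv.rangeVert j) = edge j
  vert_ghost : ∀ j, F.vert (hv.rangeVert j) * ghost j = ghost j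
  vert_edge : ∀ u j, F.vert u * edge j = 0
  ghost_vert : ∀ j u, ghost j * F.vert u = 0
  ghost_edge : ∀ j k, ghost j * edge k = if j = k then F.vert (hv.rangeVert j) else 0

namespace LonelyEdge

variable {F : LeavittFamily (H.eliminate hv) A} (L : LonelyEdge F)

/-- The idempotent to which the lonely vertex is mapped. -/
noncomputable def lonelyVert : A := ∑ j, L.edge j * L.ghost j

theorem lonelyVert_mul_edge (j : MultIndex (H.r h)) : L.lonelyVert * L.edge j = L.edge j := by
  classical
  simp only [lonelyVert, Finset.sum_mul, mul_assoc, L.ghost_edge, mul_ite, mul_zero,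
    Finset.sum_ite_eq', Finset.mem_univ, if_true, L.edge_vert]

theorem ghost_mul_lonelyVert (j : MultIndex (H.r h)) : L.ghost j * L.lonelyVert = L.ghost j := by
  classical
  simp only [lonelyVert, Finset.mul_sum, ← mul_assoc, L.ghost_edge, ite_mul, zero_mul,
    Finset.sum_ite_eq, Finset.mem_univ, if_true, L.vert_ghost]

theorem lonelyVert_mul_self : L.lonelyVert * L.lonelyVert = L.lonelyVert := by
  nth_rw 2 [lonelyVert]
  simp only [Finset.mul_sum, ← mul_assoc, lonelyVert_mul_edge]
  rfl

theorem lonelyVert_mul_vert (u : {u : V // u ≠ v}) : L.lonelyVert * F.vert u = 0 := by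
  simp only [lonelyVert, Finset.sum_mul, mul_assoc, L.ghost_vert, mul_zero, Finset.sum_const_zero]

theorem vert_mul_lonelyVert (u : {u : V // u ≠ v}) : F.vert u * L.lonelyVert = 0 := by
  simp only [lonelyVert, Finset.mul_sum, ← mul_assoc, L.vert_edge, zero_mul, Finset.sum_const_zero]

open Classical in
/-- The value of the extended family at a vertex. -/
noncomputable def extendVert (u : V) : A :=
  if hu : u = v then L.lonelyVert else F.vert ⟨u, hu⟩

open Classical in
/-- The value of the extended family at a generator `h_{ij}`. -/
noncomputable def extendEdge (g : E) (i : MultIndex (H.s g)) (j : MultIndex (H.r g)) : A :=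
  if hg : g = h then L.edge (hg ▸ j)
  else F.edge ⟨g, hg⟩ (hv.sourceEquiv ⟨g, hg⟩ i) (hv.rangeEquiv ⟨g, hg⟩ j)

open Classical in
/-- The value of the extended family at a generator `h_{ij}^*`. -/
noncomputable def extendGhost (g : E) (i : MultIndex (H.s g)) (j : MultIndex (H.r g)) : A :=
  if hg : g = h then L.ghost (hg ▸ j)
  else F.ghost ⟨g, hg⟩ (hv.sourceEquiv ⟨g, hg⟩ i) (hv.rangeEquiv ⟨g, hg⟩ j)

theorem extendVert_self : L.extendVert v = L.lonelyVert := dif_pos rfl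

theorem extendVert_of_ne {u : V} (hu : u ≠ v) : L.extendVert u = F.vert ⟨u, hu⟩ := dif_neg hu

theorem extendVert_source (i : MultIndex (H.s h)) : L.extendVert i.elt = L.lonelyVert := by
  rw [hv.source_elt_eq i, extendVert_self]

theorem extendVert_range (j : MultIndex (H.r h)) : L.extendVert j.elt = F.vert (hv.rangeVert j) :=
  L.extendVert_of_ne _

theorem extendVert_source_of_ne {g : E} (hg : g ≠ h) (i : MultIndex (H.s g)) :
    L.extendVert i.elt = F.vert (hv.sourceEquiv ⟨g, hg⟩ i).elt :=
  L.extendVert_of_ne _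

theorem extendVert_range_of_ne {g : E} (hg : g ≠ h) (j : MultIndex (H.r g)) :
    L.extendVert j.elt = F.vert (hv.rangeEquiv ⟨g, hg⟩ j).elt :=
  L.extendVert_of_ne _

theorem extendEdge_self (i : MultIndex (H.s h)) (j : MultIndex (H.r h)) :
    L.extendEdge h i j = L.edge j :=
  dif_pos rfl

theorem extendEdge_of_ne {g : E} (hg : g ≠ h) (i : MultIndex (H.s g)) (j : MultIndex (H.r g)) :
    L.extendEdge g i j = F.edge ⟨g, hg⟩ (hv.sourceEquiv ⟨g, hg⟩ i) (hv.rangeEquiv ⟨g, hg⟩ j) :=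
  dif_neg hg

theorem extendGhost_self (i : MultIndex (H.s h)) (j : MultIndex (H.r h)) :
    L.extendGhost h i j = L.ghost j :=
  dif_pos rfl

theorem extendGhost_of_ne {g : E} (hg : g ≠ h) (i : MultIndex (H.s g)) (j : MultIndex (H.r g)) :
    L.extendGhost g i j = F.ghost ⟨g, hg⟩ (hv.sourceEquiv ⟨g, hg⟩ i) (hv.rangeEquiv ⟨g, hg⟩ j) :=
  dif_neg hg

open Classical in
theorem extendVert_mul_extendVert (u w : V) :
    L.extendVert u * L.extendVert w = if u = w then L.extendVert u else 0 := by
  rcases eq_or_ne u v with hu | hu <;> rcases eq_or_ne w v with hw | hw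
  · rw [hu, hw, extendVert_self, lonelyVert_mul_self, if_pos rfl]
  · rw [hu, extendVert_self, extendVert_of_ne L hw, lonelyVert_mul_vert, if_neg hw.symm]
  · rw [hw, extendVert_self, extendVert_of_ne L hu, vert_mul_lonelyVert, if_neg hu]
  · simp only [extendVert_of_ne L hu, extendVert_of_ne L hw, F.vert_mul, Subtype.mk.injEq]

open Classical in
theorem sum_extendEdge_mul_extendGhost (g : E) (i i' : MultIndex (H.s g)) :
    ∑ j, L.extendEdge g i j * L.extendGhost g i' j = if i = i' then L.extendVert i.elt else 0 := by
  by_cases hg : g = h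
  · subst hg
    rw [if_pos ((hv.eq_source i).trans (hv.eq_source i').symm), extendVert_source]
    simp only [extendEdge_self, extendGhost_self, lonelyVert]
  · simp_rw [extendEdge_of_ne L hg, extendGhost_of_ne L hg, extendVert_source_of_ne L hg]
    rw [Equiv.sum_comp (hv.rangeEquiv ⟨g, hg⟩) fun j => F.edge ⟨g, hg⟩ _ j * F.ghost ⟨g, hg⟩ _ j,
      F.edge_ghost]
    simp only [EmbeddingLike.apply_eq_iff_eq]

open Classical in
theorem sum_extendGhost_mul_extendEdge (g : E) (j j' : MultIndex (H.r g)) :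
    ∑ i, L.extendGhost g i j * L.extendEdge g i j' = if j = j' then L.extendVert j.elt else 0 := by
  by_cases hg : g = h
  · subst hg
    rw [hv.sum_source, extendGhost_self, extendEdge_self, L.ghost_edge, extendVert_range]
  · simp_rw [extendEdge_of_ne L hg, extendGhost_of_ne L hg, extendVert_range_of_ne L hg]
    rw [Equiv.sum_comp (hv.sourceEquiv ⟨g, hg⟩) fun i => F.ghost ⟨g, hg⟩ i _ * F.edge ⟨g, hg⟩ i _,
      F.ghost_edge]
    simp only [EmbeddingLike.apply_eq_iff_eq]

/-- The extension of a Leavitt family of the hypergraph without the lonely vertex to a Leavitt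
family of the original hypergraph. -/
noncomputable def extend : LeavittFamily H A where
  vert := L.extendVert
  edge := L.extendEdge
  ghost := L.extendGhost
  vert_mul := L.extendVert_mul_extendVert
  edge_ghost := L.sum_extendEdge_mul_extendGhost
  ghost_edge := L.sum_extendGhost_mul_extendEdge
  vert_edge g i j := by
    by_cases hg : g = h
    · subst hg; rw [extendEdge_self, extendVert_source, lonelyVert_mul_edge]
    · rw [extendEdge_of_ne L hg, extendVert_source_of_ne L hg, F.vert_edge]
  edge_vert g i j := by
    by_cases hg : g = h
    · subst hg; rw [extendEdge_self, extendVert_range, L.edge_vert]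
    · rw [extendEdge_of_ne L hg, extendVert_range_of_ne L hg, F.edge_vert]
  vert_ghost g i j := by
    by_cases hg : g = h
    · subst hg; rw [extendGhost_self, extendVert_range, L.vert_ghost]
    · rw [extendGhost_of_ne L hg, extendVert_range_of_ne L hg, F.vert_ghost]
  ghost_vert g i j := by
    by_cases hg : g = h
    · subst hg; rw [extendGhost_self, extendVert_source, ghost_mul_lonelyVert]
    · rw [extendGhost_of_ne L hg, extendVert_source_of_ne L hg, F.ghost_vert]

theorem gen_extend (g : (H.eliminate hv).LGen) : L.extend.gen (hv.liftGen g) = F.gen g := by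
  cases g with
  | vert u => exact L.extendVert_of_ne u.2
  | edge g i j => exact L.extendEdge_of_ne g.2 _ _
  | ghost g i j => exact L.extendGhost_of_ne g.2 _ _

end LonelyEdge

end LeavittFamily

end OrientedHypergraph

/-! ### Injectivity by matrix units -/

section MatrixSingle

variable {n : Type*} [Fintype n] [DecidableEq n] (K : Type*) [CommSemiring K] {A : Type*}
  [Semiring A] [Algebra K A]

/-- The embedding of an algebra as the diagonal `(p, p)` entry of a matrix algebra. -/
def matrixSingleHom (p : n) : A →ₙₐ[K] Matrix n n A where
  toFun := Matrix.single p p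
  map_smul' k a := (Matrix.smul_single k p p a).symm
  map_zero' := Matrix.single_zero p p
  map_add' := Matrix.single_add p p
  map_mul' a b := (Matrix.single_mul_single_same a p p p b).symm

theorem matrixSingleHom_injective (p : n) :
    Function.Injective (matrixSingleHom K p : A →ₙₐ[K] Matrix n n A) :=
  fun a b hab => by
    have hab' : Matrix.single p p a = Matrix.single p p b := hab
    simpa only [Matrix.single_apply_same] using congrFun (congrFun hab' p) p

end MatrixSingle

namespace OrientedHypergraph

section Injective

variable {V E : Type*} [Finite V] {H : OrientedHypergraph V E} {v : V} {h : E}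
  (hv : H.IsLonely v h) (K : Type*) [Field K]

open Classical in
/-- The matrix units `h_j = e_{j0}`, `h_j^* = e_{0j}` that extend a Leavitt family, placed in the
corner at `0 = none` of a matrix algebra, to a lonely vertex and its hyperedge. -/
noncomputable def matrixLonelyEdge {A : Type*} [Ring A] [Algebra K A]
    (F : LeavittFamily (H.eliminate hv) A) :
    LeavittFamily.LonelyEdge <| F.map <| NonUnitalRingHomClass.toNonUnitalRingHom
      (matrixSingleHom K (none : Option (MultIndex (H.r h))) : A →ₙₐ[K] Matrix _ _ A) where
  edge j := Matrix.single (some j) none (F.vert (hv.rangeVert j))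
  ghost j := Matrix.single none (some j) (F.vert (hv.rangeVert j))
  edge_vert j := by
    refine (Matrix.single_mul_single_same ..).trans ?_
    rw [F.vert_mul_self]
  vert_ghost j := by
    refine (Matrix.single_mul_single_same ..).trans ?_
    rw [F.vert_mul_self]
  vert_edge u j := Matrix.single_mul_single_of_ne _ _ _ _ (Option.some_ne_none j).symm _
  ghost_vert j u := Matrix.single_mul_single_of_ne _ _ _ _ (Option.some_ne_none j) _
  ghost_edge j k := by
    split_ifs with hjk
    · rw [hjk, Matrix.single_mul_single_same, F.vert_mul_self]
      rfl
    · exact Matrix.single_mul_single_of_ne _ _ _ _ (fun hs => hjk (Option.some_injective _ hs)) _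

namespace IsLonely

/-- The homomorphism `L(H') → L(H)`, where `H'` is obtained from `H` by eliminating a lonely
vertex. -/
noncomputable def cornerHom :
    LeavittPathAlgebra K (H.eliminate hv) →ₙₐ[K] LeavittPathAlgebra K H :=
  ((H.leavittFamily K).restrict hv).lift K

theorem cornerHom_gen (g : (H.eliminate hv).LGen) :
    hv.cornerHom K (((H.eliminate hv).leavittFamily K).gen g) =
      (H.leavittFamily K).gen (hv.liftGen g) := by
  rw [cornerHom, LeavittFamily.lift_gen, LeavittFamily.gen_restrict]

theorem cornerHom_injective : Function.Injective (hv.cornerHom K) := by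
  classical
  let F := (H.eliminate hv).leavittFamily K
  let ψ := (matrixLonelyEdge hv K F).extend.lift K
  have hψ : ψ.comp (hv.cornerHom K) = matrixSingleHom K none :=
    leavitt_nonUnitalAlgHom_ext fun g => by
      rw [NonUnitalAlgHom.comp_apply, cornerHom_gen, LeavittFamily.lift_gen,
        LeavittFamily.LonelyEdge.gen_extend]
      cases g <;> rfl
  refine Function.Injective.of_comp (f := ψ) ?_
  rw [← NonUnitalAlgHom.coe_comp, hψ]
  exact matrixSingleHom_injective K none

end IsLonely

end Injective

end OrientedHypergraph

/-! ### The corner of a Leavitt path algebra at the vertices other than a lonely one -/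

section Blocks

variable {K A ι : Type*} [CommSemiring K] [Semiring A] [Algebra K A] [Fintype ι]
  (S : NonUnitalSubalgebra K A) (row col : ι → A)

/-- If `∑_p row_p col_p = 1`, then `b ↦ (col_p b row_q)_{p,q}` is multiplicative. This is the
subalgebra of all `b` for which the matrix has entries in `S`. -/
def blockSubalgebra (hone : ∑ p, row p * col p = 1) : NonUnitalSubalgebra K A where
  carrier := {b | ∀ p q, col p * b * row q ∈ S}
  zero_mem' p q := by rw [mul_zero, zero_mul]; exact zero_mem S
  add_mem' hb hc p q := by rw [mul_add, add_mul]; exact add_mem (hb p q) (hc p q)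
  smul_mem' k b hb p q := by rw [mul_smul_comm, smul_mul_assoc]; exact S.smul_mem k (hb p q)
  mul_mem' {b c} hb hc p q := by
    have hsum : col p * (b * c) * row q = ∑ r, (col p * b * row r) * (col r * c * row q) :=
      calc col p * (b * c) * row q = col p * b * (∑ r, row r * col r) * c * row q := by
            rw [hone, mul_one, ← mul_assoc (col p)]
        _ = _ := by simp only [Finset.mul_sum, Finset.sum_mul, mul_assoc]
    rw [hsum]
    exact sum_mem fun r _ => mul_mem (hb p r) (hc r q)

variable {S row col}

theorem mul_mul_mem_blockSubalgebra (hone : ∑ p, row p * col p = 1)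
    (hS : ∀ p q, col p * row q ∈ S) {x : A} (hx : x ∈ S) (p q : ι) :
    row p * x * col q ∈ blockSubalgebra S row col hone := fun r s => by
  have hassoc : col r * (row p * x * col q) * row s = col r * row p * x * (col q * row s) := by
    simp only [mul_assoc]
  rw [hassoc]
  exact mul_mem (mul_mem (hS r p) hx) (hS q s)

end Blocks

namespace OrientedHypergraph

namespace LeavittFamily

section Lonely

variable {V E : Type*} [Finite V] {H : OrientedHypergraph V E} {v : V} {h : E}
  (hv : H.IsLonely v h) {A : Type*} [NonUnitalSemiring A] (F : LeavittFamily H A)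

theorem unit_restrict_add_vert : (F.restrict hv).unit + F.vert v = F.unit := by
  classical
  have := Fintype.ofFinite V
  rw [unit_eq_sum, unit_eq_sum, ← Finset.sum_erase_add _ _ (Finset.mem_univ v)]
  congr 1
  exact (Finset.sum_subtype (Finset.univ.erase v) (by simp) F.vert).symm

theorem unit_restrict_mul_vert : (F.restrict hv).unit * F.vert v = 0 := by
  classical
  have := Fintype.ofFinite V
  rw [unit_eq_sum, Finset.sum_mul]
  exact Finset.sum_eq_zero fun u _ => (F.vert_mul u.1 v).trans (if_neg u.2)

theorem vert_mul_unit_restrict : F.vert v * (F.restrict hv).unit = 0 := by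
  classical
  have := Fintype.ofFinite V
  rw [unit_eq_sum, Finset.mul_sum]
  exact Finset.sum_eq_zero fun u _ => (F.vert_mul v u.1).trans (if_neg u.2.symm)

theorem unit_restrict_mul_edge (j : MultIndex (H.r h)) :
    (F.restrict hv).unit * F.edge h hv.source j = 0 := by
  rw [← F.vert_edge, ← mul_assoc, hv.source_elt_eq, unit_restrict_mul_vert, zero_mul]

theorem ghost_mul_unit_restrict (j : MultIndex (H.r h)) :
    F.ghost h hv.source j * (F.restrict hv).unit = 0 := by
  rw [← F.ghost_vert, mul_assoc, hv.source_elt_eq, vert_mul_unit_restrict, mul_zero]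

theorem edge_mul_unit_restrict (j : MultIndex (H.r h)) :
    F.edge h hv.source j * (F.restrict hv).unit = F.edge h hv.source j := by
  rw [← F.edge_vert, mul_assoc]
  exact congrArg _ ((F.restrict hv).vert_mul_unit (hv.rangeVert j))

theorem unit_restrict_mul_ghost (j : MultIndex (H.r h)) :
    (F.restrict hv).unit * F.ghost h hv.source j = F.ghost h hv.source j := by
  rw [← F.vert_ghost, ← mul_assoc]
  exact congrArg (· * _) ((F.restrict hv).unit_mul_vert (hv.rangeVert j))

theorem vert_eq_sum_edge_mul_ghost :
    F.vert v = ∑ j, F.edge h hv.source j * F.ghost h hv.source j := by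
  rw [F.edge_ghost, if_pos rfl, hv.source_elt_eq]

open Classical in
theorem ghost_mul_edge (j k : MultIndex (H.r h)) :
    F.ghost h hv.source j * F.edge h hv.source k = if j = k then F.vert j.elt else 0 := by
  rw [← F.ghost_edge, hv.sum_source]

/-- The row `(e, h_1, h_2, …)`, where `h_j` are the generators for the hyperedge `h` of a lonely
vertex `v`, and `e` is the sum of the vertices other than `v`. -/
noncomputable def row : Option (MultIndex (H.r h)) → A
  | none => (F.restrict hv).unit
  | some j => F.edge h hv.source j

/-- The column `(e, h_1^*, h_2^*, …)` corresponding to the row `LeavittFamily.row`. -/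
noncomputable def col : Option (MultIndex (H.r h)) → A
  | none => (F.restrict hv).unit
  | some j => F.ghost h hv.source j

theorem row_mul_unit_restrict (p : Option (MultIndex (H.r h))) :
    F.row hv p * (F.restrict hv).unit = F.row hv p := by
  cases p with
  | none => exact (F.restrict hv).isIdempotentElem_unit.eq
  | some j => exact F.edge_mul_unit_restrict hv j

theorem sum_row_mul_col : ∑ p, F.row hv p * F.col hv p = F.unit := by
  rw [Fintype.sum_option, ← F.unit_restrict_add_vert hv, F.vert_eq_sum_edge_mul_ghost hv]
  congr 1
  exact (F.restrict hv).isIdempotentElem_unit.eq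

end Lonely

section Lift

variable {V E : Type*} [Finite V] {H : OrientedHypergraph V E} (K : Type*) [Field K] {A : Type*}
  [Ring A] [Algebra K A] (F : LeavittFamily H A)

theorem lift_one : F.lift K 1 = F.unit := congrArg Subtype.val (map_one (F.liftCorner K))

theorem unit_mul_lift (a : LeavittPathAlgebra K H) : F.unit * F.lift K a = F.lift K a :=
  ((Subsemigroup.mem_corner_iff F.isIdempotentElem_unit).1 (F.liftCorner K a).2).1

theorem lift_mul_unit (a : LeavittPathAlgebra K H) : F.lift K a * F.unit = F.lift K a :=
  ((Subsemigroup.mem_corner_iff F.isIdempotentElem_unit).1 (F.liftCorner K a).2).2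

end Lift

end LeavittFamily

namespace IsLonely

variable {V E : Type*} [Finite V] {H : OrientedHypergraph V E} {v : V} {h : E}
  (hv : H.IsLonely v h) (K : Type*) [Field K]

theorem unit_restrict : ((H.leavittFamily K).restrict hv).unit = H.coVertL K v := rfl

include hv in
theorem isIdempotentElem_coVertL : IsIdempotentElem (H.coVertL K v) :=
  ((H.leavittFamily K).restrict hv).isIdempotentElem_unit

theorem sum_leavittFamily_row_mul_col :
    ∑ p, (H.leavittFamily K).row hv p * (H.leavittFamily K).col hv p = 1 := by
  rw [LeavittFamily.sum_row_mul_col, unit_leavittFamily]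

include hv in
theorem span_coVertL_eq_top : TwoSidedIdeal.span {H.coVertL K v} = ⊤ := by
  rw [← TwoSidedIdeal.one_mem_iff, ← hv.sum_leavittFamily_row_mul_col K]
  refine sum_mem fun p _ => ?_
  rw [← LeavittFamily.row_mul_unit_restrict]
  exact TwoSidedIdeal.mul_mem_right _ _ _ <| TwoSidedIdeal.mul_mem_left _ _ _ <|
    TwoSidedIdeal.subset_span (hv.unit_restrict K)

theorem col_mul_row_mem_range (p q : Option (MultIndex (H.r h))) :
    (H.leavittFamily K).col hv p * (H.leavittFamily K).row hv q ∈
      NonUnitalAlgHom.range (hv.cornerHom K) := by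
  classical
  match p, q with
  | none, none =>
    exact ⟨1, (LeavittFamily.lift_one ..).trans (hv.isIdempotentElem_coVertL K).eq.symm⟩
  | none, some j => exact ⟨0, (map_zero _).trans (LeavittFamily.unit_restrict_mul_edge ..).symm⟩
  | some j, none => exact ⟨0, (map_zero _).trans (LeavittFamily.ghost_mul_unit_restrict ..).symm⟩
  | some j, some k =>
    refine (LeavittFamily.ghost_mul_edge hv (H.leavittFamily K) j k).symm ▸ ?_
    split_ifs
    · exact ⟨_, hv.cornerHom_gen K (.vert (hv.rangeVert j))⟩
    · exact zero_mem _

/-- The elements `b` of `L(H)` such that `(col_p b row_q)_{p,q}` has entries in the image of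
`L(H')`. -/
noncomputable def blocks : NonUnitalSubalgebra K (LeavittPathAlgebra K H) :=
  blockSubalgebra (NonUnitalAlgHom.range (hv.cornerHom K)) ((H.leavittFamily K).row hv)
    ((H.leavittFamily K).col hv) (hv.sum_leavittFamily_row_mul_col K)

theorem row_mul_cornerHom_mul_col_mem_blocks (a : LeavittPathAlgebra K (H.eliminate hv))
    (p q : Option (MultIndex (H.r h))) :
    (H.leavittFamily K).row hv p * hv.cornerHom K a * (H.leavittFamily K).col hv q ∈
      hv.blocks K :=
  mul_mul_mem_blockSubalgebra _ (hv.col_mul_row_mem_range K) ⟨a, rfl⟩ p q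

theorem row_mul_col_mem_blocks (p q : Option (MultIndex (H.r h))) :
    (H.leavittFamily K).row hv p * (H.leavittFamily K).col hv q ∈ hv.blocks K := by
  have hmem := hv.row_mul_cornerHom_mul_col_mem_blocks K 1 p q
  rwa [cornerHom, LeavittFamily.lift_one, LeavittFamily.row_mul_unit_restrict] at hmem

theorem cornerHom_mem_blocks (a : LeavittPathAlgebra K (H.eliminate hv)) :
    hv.cornerHom K a ∈ hv.blocks K := by
  have hmem := hv.row_mul_cornerHom_mul_col_mem_blocks K a none none
  rwa [LeavittFamily.row, LeavittFamily.col, cornerHom, LeavittFamily.unit_mul_lift,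
    LeavittFamily.lift_mul_unit] at hmem

theorem gen_mem_blocks (g : H.LGen) : (H.leavittFamily K).gen g ∈ hv.blocks K := by
  let F := H.leavittFamily K
  have gen_liftGen_mem (g : (H.eliminate hv).LGen) : F.gen (hv.liftGen g) ∈ hv.blocks K := by
    rw [← cornerHom_gen]
    exact hv.cornerHom_mem_blocks K _
  cases g with
  | vert u =>
    obtain rfl | hu := eq_or_ne u v
    · rw [LeavittFamily.gen, F.vert_eq_sum_edge_mul_ghost hv]
      exact sum_mem fun j _ => hv.row_mul_col_mem_blocks K (some j) (some j)
    · exact gen_liftGen_mem (.vert ⟨u, hu⟩)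
  | edge g i j =>
    obtain rfl | hg := eq_or_ne g h
    · rw [LeavittFamily.gen, hv.eq_source i, ← F.edge_mul_unit_restrict hv]
      exact hv.row_mul_col_mem_blocks K (some j) none
    · exact gen_liftGen_mem (.edge ⟨g, hg⟩ (hv.sourceEquiv ⟨g, hg⟩ i) (hv.rangeEquiv ⟨g, hg⟩ j))
  | ghost g i j =>
    obtain rfl | hg := eq_or_ne g h
    · rw [LeavittFamily.gen, hv.eq_source i, ← F.unit_restrict_mul_ghost hv]
      exact hv.row_mul_col_mem_blocks K none (some j)
    · exact gen_liftGen_mem (.ghost ⟨g, hg⟩ (hv.sourceEquiv ⟨g, hg⟩ i) (hv.rangeEquiv ⟨g, hg⟩ j))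

theorem blocks_eq_top : hv.blocks K = ⊤ := by
  rw [eq_top_iff, ← adjoin_range_gen_leavittFamily]
  exact NonUnitalAlgebra.adjoin_le <| Set.range_subset_iff.2 (hv.gen_mem_blocks K)

theorem range_cornerHom :
    Set.range (hv.cornerHom K) = {x | ∃ a, x = H.coVertL K v * a * H.coVertL K v} := by
  refine Set.Subset.antisymm ?_ ?_
  · rintro _ ⟨a, rfl⟩
    refine ⟨hv.cornerHom K a, ?_⟩
    rw [← hv.unit_restrict, cornerHom, LeavittFamily.unit_mul_lift, LeavittFamily.lift_mul_unit]
  · rintro _ ⟨b, rfl⟩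
    have hb : b ∈ hv.blocks K := by rw [blocks_eq_top]; exact NonUnitalAlgebra.mem_top
    exact hb none none

/-- The Leavitt path algebra of the hypergraph obtained by eliminating a lonely vertex as a corner
of the original one. -/
noncomputable def cornerEquiv :
    LeavittPathAlgebra K (H.eliminate hv) ≃ₐ[K] (hv.isIdempotentElem_coVertL K).Corner :=
  AlgEquiv.ofBijective (((H.leavittFamily K).restrict hv).liftCorner K)
    ⟨fun _ _ hab => hv.cornerHom_injective K (congrArg Subtype.val hab), fun c => by
      obtain ⟨b, hb⟩ := c.2
      obtain ⟨a, ha⟩ := (hv.range_cornerHom K).ge ⟨b, hb.symm⟩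
      exact ⟨a, Subtype.ext ha⟩⟩

theorem isMoritaEquivalent_leavittPathAlgebra :
    IsMoritaEquivalent K (LeavittPathAlgebra K (H.eliminate hv)) (LeavittPathAlgebra K H) :=
  (IsMoritaEquivalent.of_algEquiv K (hv.cornerEquiv K)).trans K <|
    isMoritaEquivalent_corner K _ (hv.span_coVertL_eq_top K)

end IsLonely

end OrientedHypergraph

/-! ### Bergman algebras of basic presentations as Leavitt path algebras -/

namespace BergmanPresentation

variable {X I : Type*}

/-- The hypergraph whose Leavitt path algebra is the Bergman algebra of a basic presentation: the
vertices are the generators, and the hyperedges are the relations. -/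
abbrev hypergraph (P : BergmanPresentation X I) : OrientedHypergraph X I where
  s i x := P.a i x
  r i x := P.b i x
  s_nonempty i := DFunLike.ne_iff.1 (P.a_ne_zero i)
  r_nonempty i := DFunLike.ne_iff.1 (P.b_ne_zero i)

namespace IsBasic

variable {P : BergmanPresentation X I} (hP : P.IsBasic)

include hP in
theorem mem_base (x : X) : x ∈ P.base := hP.ge trivial

include hP in
theorem subsingleton_idx (x : X) : Subsingleton (P.Idx x) where
  allEq
    | .base .., .base .. => rfl
    | .step i hi .., _ => absurd hi (hP.blue_eq i)
    | _, .step i hi .. => absurd hi (hP.blue_eq i)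

/-- The only row of the `1 × 1` matrix `ε_x`. -/
def idx (x : X) : P.Idx x := .base x (hP.mem_base x)

theorem eq_idx {x : X} (p : P.Idx x) : p = hP.idx x :=
  (hP.subsingleton_idx x).elim _ _

/-- In a basic presentation, the rows of `ε_c` correspond to the summands of `c`. -/
def sumIdx (c : X →₀ ℕ) : MultIndex c ≃ P.SumIdx c where
  toFun y := ⟨y, hP.idx y.elt⟩
  invFun := SumIdx.summand
  left_inv _ := rfl
  right_inv p := congrArg (SumIdx.mk p.summand) (hP.eq_idx p.idx).symm

/-- The generators of the Bergman algebra of a basic presentation correspond to the generators of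
the Leavitt path algebra of its hypergraph. -/
def genEquiv [Finite X] : P.BGen ≃ P.hypergraph.LGen where
  toFun
    | .eps x _ _ => .vert x
    | .sig i _ p q => .edge i p.summand q.summand
    | .sig' i _ q p => .ghost i p.summand q.summand
  invFun
    | .vert x => .eps x (hP.idx x) (hP.idx x)
    | .edge i p q => .sig i (hP.blue_eq i) (hP.sumIdx _ p) (hP.sumIdx _ q)
    | .ghost i p q => .sig' i (hP.blue_eq i) (hP.sumIdx _ q) (hP.sumIdx _ p)
  left_inv
    | .eps x p q => congrArg₂ (BGen.eps x) (hP.eq_idx p).symm (hP.eq_idx q).symm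
    | .sig i hi p q => congrArg₂ (BGen.sig i hi)
      ((hP.sumIdx _).apply_symm_apply p) ((hP.sumIdx _).apply_symm_apply q)
    | .sig' i hi q p => congrArg₂ (BGen.sig' i hi)
      ((hP.sumIdx _).apply_symm_apply q) ((hP.sumIdx _).apply_symm_apply p)
  right_inv g := by cases g <;> rfl

variable (K : Type*) [Field K]

open Classical in
theorem epsSum_sumIdx (c : X →₀ ℕ) (y z : MultIndex c) :
    epsSum K P c (hP.sumIdx c y) (hP.sumIdx c z) =
      if y = z then epsBase K P ⟨y.elt, hP.mem_base _⟩ else 0 := by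
  obtain rfl | hyz := eq_or_ne y z
  · rw [if_pos rfl]
    exact dif_pos (rfl : (hP.sumIdx c y).summand = (hP.sumIdx c y).summand)
  · rw [if_neg hyz]
    exact dif_neg (c := (hP.sumIdx c z).summand = (hP.sumIdx c y).summand) hyz.symm

variable [Finite X]

theorem mul_sumIdx_apply {m n A : Type*} [NonUnitalNonAssocSemiring A] (c : X →₀ ℕ)
    (M : Matrix m (P.SumIdx c) A) (N : Matrix (P.SumIdx c) n A) (p : m) (q : n) :
    (M * N) p q = ∑ y, M p (hP.sumIdx c y) * N (hP.sumIdx c y) q :=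
  (Equiv.sum_comp (hP.sumIdx c) fun r => M p r * N r q).symm

theorem epsSum_mul_mul_epsSum_apply (c d : X →₀ ℕ)
    (M : Matrix (P.SumIdx c) (P.SumIdx d) (FreeAlgebra K P.BGen)) (y : MultIndex c)
    (z : MultIndex d) :
    (epsSum K P c * M * epsSum K P d) (hP.sumIdx c y) (hP.sumIdx d z) =
      epsBase K P ⟨y.elt, hP.mem_base _⟩ * M (hP.sumIdx c y) (hP.sumIdx d z) *
        epsBase K P ⟨z.elt, hP.mem_base _⟩ := by
  classical
  simp only [hP.mul_sumIdx_apply, epsSum_sumIdx, ite_mul, mul_ite, zero_mul, mul_zero,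
    Finset.sum_ite_eq, Finset.sum_ite_eq', Finset.mem_univ, if_true]

section FreeLift

variable {A : Type*} [Semiring A] [Algebra K A] (F : P.hypergraph.LeavittFamily A)

/-- The homomorphism that maps the generators of the Bergman algebra of a basic presentation to the
corresponding members of a Leavitt family. -/
noncomputable def freeLift : FreeAlgebra K P.BGen →ₐ[K] A :=
  FreeAlgebra.lift K (F.gen ∘ hP.genEquiv)

theorem freeLift_epsBase (x : P.base) : hP.freeLift K F (epsBase K P x) = F.vert x.1 :=
  FreeAlgebra.lift_ι_apply _ _

theorem freeLift_sigma (i : I) (hi : i ∉ P.blue) (p : MultIndex (P.a i))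
    (q : MultIndex (P.b i)) :
    hP.freeLift K F (sigma K P i hi (hP.sumIdx _ p) (hP.sumIdx _ q)) = F.edge i p q :=
  FreeAlgebra.lift_ι_apply _ _

theorem freeLift_sigma' (i : I) (hi : i ∉ P.blue) (p : MultIndex (P.a i))
    (q : MultIndex (P.b i)) :
    hP.freeLift K F (sigma' K P i hi (hP.sumIdx _ q) (hP.sumIdx _ p)) = F.ghost i p q :=
  FreeAlgebra.lift_ι_apply _ _

open Classical in
theorem freeLift_epsSum (c : X →₀ ℕ) (y z : MultIndex c) :
    hP.freeLift K F (epsSum K P c (hP.sumIdx c y) (hP.sumIdx c z)) =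
      if y = z then F.vert y.elt else 0 := by
  rw [epsSum_sumIdx, apply_ite (hP.freeLift K F), map_zero, freeLift_epsBase]

theorem freeLift_eq_of_rel (hF : F.unit = 1) {a b : FreeAlgebra K P.BGen} (hab : BRel K P a b) :
    hP.freeLift K F a = hP.freeLift K F b := by
  classical
  have := Fintype.ofFinite X
  induction hab with
  | base_mul x y =>
    simp only [map_mul, map_zero, apply_ite (hP.freeLift K F), freeLift_epsBase, F.vert_mul,
      Subtype.ext_iff]
  | base_sum =>
    rw [finsum_eq_sum_of_fintype, map_sum, map_one, ← hF, F.unit_eq_sum]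
    simp only [freeLift_epsBase]
    exact Fintype.sum_equiv (Equiv.subtypeUnivEquiv hP.mem_base) _ _ fun _ => rfl
  | blue_mul i hi => exact absurd hi (hP.blue_eq i)
  | blue_sum i hi => exact absurd hi (hP.blue_eq i)
  | red_sigma i hi p q =>
    obtain ⟨p, rfl⟩ := (hP.sumIdx _).surjective p
    obtain ⟨q, rfl⟩ := (hP.sumIdx _).surjective q
    rw [epsSum_mul_mul_epsSum_apply, map_mul, map_mul, freeLift_epsBase, freeLift_epsBase,
      freeLift_sigma, F.vert_edge i p q, F.edge_vert i p q]
  | red_sigma' i hi q p =>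
    obtain ⟨p, rfl⟩ := (hP.sumIdx _).surjective p
    obtain ⟨q, rfl⟩ := (hP.sumIdx _).surjective q
    rw [epsSum_mul_mul_epsSum_apply, map_mul, map_mul, freeLift_epsBase, freeLift_epsBase,
      freeLift_sigma', F.vert_ghost i p q, F.ghost_vert i p q]
  | red_left i hi p q =>
    obtain ⟨p, rfl⟩ := (hP.sumIdx _).surjective p
    obtain ⟨q, rfl⟩ := (hP.sumIdx _).surjective q
    simp only [hP.mul_sumIdx_apply, map_sum, map_mul, freeLift_sigma, freeLift_sigma',
      freeLift_epsSum, F.edge_ghost]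
  | red_right i hi p q =>
    obtain ⟨p, rfl⟩ := (hP.sumIdx _).surjective p
    obtain ⟨q, rfl⟩ := (hP.sumIdx _).surjective q
    simp only [hP.mul_sumIdx_apply, map_sum, map_mul, freeLift_sigma, freeLift_sigma',
      freeLift_epsSum, F.ghost_edge]

end FreeLift

theorem mk_epsBase_mul_self (x : P.base) :
    RingQuot.mkAlgHom K (BRel K P) (epsBase K P x) *
      RingQuot.mkAlgHom K (BRel K P) (epsBase K P x) =
        RingQuot.mkAlgHom K (BRel K P) (epsBase K P x) := by
  rw [← map_mul, RingQuot.mkAlgHom_rel K (BRel.base_mul x x), if_pos rfl]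

theorem mk_epsBase_mul_sigma_mul_epsBase (i : I) (p : MultIndex (P.a i)) (q : MultIndex (P.b i)) :
    RingQuot.mkAlgHom K (BRel K P) (epsBase K P ⟨p.elt, hP.mem_base _⟩) *
      RingQuot.mkAlgHom K (BRel K P)
        (sigma K P i (hP.blue_eq i) (hP.sumIdx _ p) (hP.sumIdx _ q)) *
      RingQuot.mkAlgHom K (BRel K P) (epsBase K P ⟨q.elt, hP.mem_base _⟩) =
    RingQuot.mkAlgHom K (BRel K P)
      (sigma K P i (hP.blue_eq i) (hP.sumIdx _ p) (hP.sumIdx _ q)) := by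
  rw [← map_mul, ← map_mul, ← epsSum_mul_mul_epsSum_apply,
    RingQuot.mkAlgHom_rel K (BRel.red_sigma ..)]

theorem mk_epsBase_mul_sigma'_mul_epsBase (i : I) (p : MultIndex (P.a i))
    (q : MultIndex (P.b i)) :
    RingQuot.mkAlgHom K (BRel K P) (epsBase K P ⟨q.elt, hP.mem_base _⟩) *
      RingQuot.mkAlgHom K (BRel K P)
        (sigma' K P i (hP.blue_eq i) (hP.sumIdx _ q) (hP.sumIdx _ p)) *
      RingQuot.mkAlgHom K (BRel K P) (epsBase K P ⟨p.elt, hP.mem_base _⟩) =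
    RingQuot.mkAlgHom K (BRel K P)
      (sigma' K P i (hP.blue_eq i) (hP.sumIdx _ q) (hP.sumIdx _ p)) := by
  rw [← map_mul, ← map_mul, ← epsSum_mul_mul_epsSum_apply,
    RingQuot.mkAlgHom_rel K (BRel.red_sigma' ..)]

/-- The generators of the Bergman algebra of a basic presentation as a Leavitt family. -/
noncomputable def family : P.hypergraph.LeavittFamily (P.BergmanAlgebra K) where
  vert x := RingQuot.mkAlgHom K (BRel K P) (epsBase K P ⟨x, hP.mem_base x⟩)
  edge i p q := RingQuot.mkAlgHom K (BRel K P)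
    (sigma K P i (hP.blue_eq i) (hP.sumIdx _ p) (hP.sumIdx _ q))
  ghost i p q := RingQuot.mkAlgHom K (BRel K P)
    (sigma' K P i (hP.blue_eq i) (hP.sumIdx _ q) (hP.sumIdx _ p))
  vert_mul x y := by
    rw [← map_mul, RingQuot.mkAlgHom_rel K (BRel.base_mul _ _),
      apply_ite (RingQuot.mkAlgHom K (BRel K P)), map_zero]
    classical
    exact if_congr Subtype.mk_eq_mk rfl rfl
  vert_edge i p q := by
    rw [← hP.mk_epsBase_mul_sigma_mul_epsBase, ← mul_assoc, ← mul_assoc, mk_epsBase_mul_self]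
  edge_vert i p q := by
    rw [← hP.mk_epsBase_mul_sigma_mul_epsBase, mul_assoc, mk_epsBase_mul_self]
  vert_ghost i p q := by
    rw [← hP.mk_epsBase_mul_sigma'_mul_epsBase, ← mul_assoc, ← mul_assoc, mk_epsBase_mul_self]
  ghost_vert i p q := by
    rw [← hP.mk_epsBase_mul_sigma'_mul_epsBase, mul_assoc, mk_epsBase_mul_self]
  edge_ghost i p p' := by
    simp only [← map_mul, ← map_sum]
    rw [← mul_sumIdx_apply, RingQuot.mkAlgHom_rel K (BRel.red_left i _ _ _), epsSum_sumIdx,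
      apply_ite (RingQuot.mkAlgHom K (BRel K P)), map_zero]
  ghost_edge i q q' := by
    simp only [← map_mul, ← map_sum]
    rw [← mul_sumIdx_apply, RingQuot.mkAlgHom_rel K (BRel.red_right i _ _ _), epsSum_sumIdx,
      apply_ite (RingQuot.mkAlgHom K (BRel K P)), map_zero]

theorem gen_family (g : P.hypergraph.LGen) :
    (hP.family K).gen g =
      RingQuot.mkAlgHom K (BRel K P) (FreeAlgebra.ι K (hP.genEquiv.symm g)) := by
  cases g <;> rfl

theorem unit_family : (hP.family K).unit = 1 := by
  classical
  have := Fintype.ofFinite X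
  have hsum := RingQuot.mkAlgHom_rel K (BRel.base_sum (K := K) (P := P))
  rw [finsum_eq_sum_of_fintype, map_sum, map_one] at hsum
  rw [OrientedHypergraph.LeavittFamily.unit_eq_sum, ← hsum]
  exact (Fintype.sum_equiv (Equiv.subtypeUnivEquiv hP.mem_base) _ _ fun _ => rfl).symm

/-- The homomorphism from the Bergman algebra of a basic presentation to the Leavitt path algebra
of its hypergraph. -/
noncomputable def toLeavitt : P.BergmanAlgebra K →ₐ[K] P.hypergraph.LeavittPathAlgebra K :=
  RingQuot.liftAlgHom K ⟨hP.freeLift K (P.hypergraph.leavittFamily K), fun _ _ =>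
    hP.freeLift_eq_of_rel K _ (P.hypergraph.unit_leavittFamily K)⟩

theorem toLeavitt_mk_ι (g : P.BGen) :
    hP.toLeavitt K (RingQuot.mkAlgHom K (BRel K P) (FreeAlgebra.ι K g)) =
      (P.hypergraph.leavittFamily K).gen (hP.genEquiv g) := by
  rw [toLeavitt, RingQuot.liftAlgHom_mkAlgHom_apply, freeLift, FreeAlgebra.lift_ι_apply,
    Function.comp_apply]

/-- The isomorphism of the Bergman algebra of a basic presentation with the Leavitt path algebra
of its hypergraph. -/
noncomputable def leavittEquiv : P.BergmanAlgebra K ≃ₐ[K] P.hypergraph.LeavittPathAlgebra K :=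
  AlgEquiv.ofAlgHom (hP.toLeavitt K) ((hP.family K).liftUnital K (hP.unit_family K))
    (RingQuot.ringQuot_ext' _ _ _ <| FreeAlgebra.hom_ext <| funext fun g => by
      simp only [Function.comp_apply, AlgHom.comp_apply, AlgHom.id_apply,
        ← OrientedHypergraph.gen_leavittFamily, OrientedHypergraph.LeavittFamily.liftUnital_gen,
        gen_family, toLeavitt_mk_ι, Equiv.apply_symm_apply])
    (RingQuot.ringQuot_ext' _ _ _ <| FreeAlgebra.hom_ext <| funext fun g => by
      simp only [Function.comp_apply, AlgHom.comp_apply, AlgHom.id_apply, toLeavitt_mk_ι,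
        OrientedHypergraph.LeavittFamily.liftUnital_gen, gen_family, Equiv.symm_apply_apply])

end IsBasic

theorem IsBasic.eliminate {P : BergmanPresentation X I} (hP : P.IsBasic) {x : X} {i : I}
    (hx : P.IsLonely x i) : (P.eliminate hP hx).IsBasic :=
  Set.eq_univ_of_forall fun _ j hj => absurd hj (hP.blue_eq j.1)

theorem IsLonely.hypergraph {P : BergmanPresentation X I} {x : X} {i : I} (hx : P.IsLonely x i) :
    P.hypergraph.IsLonely x i where
  source_self := (DFunLike.congr_fun hx.left_eq x).trans Finsupp.single_eq_same
  source_ne y hy := (DFunLike.congr_fun hx.left_eq y).trans (Finsupp.single_eq_of_ne hy)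
  not_range := hx.right_eq
  other := hx.other

theorem isMoritaEquivalent_eliminate [Finite X] (K : Type*) [Field K]
    {P : BergmanPresentation X I} (hP : P.IsBasic) {x : X} {i : I} (hx : P.IsLonely x i) :
    IsMoritaEquivalent K (BergmanAlgebra K (P.eliminate hP hx)) (BergmanAlgebra K P) :=
  ((IsMoritaEquivalent.of_algEquiv K ((hP.eliminate hx).leavittEquiv K)).trans K
    (hx.hypergraph.isMoritaEquivalent_leavittPathAlgebra K)).trans K
    (IsMoritaEquivalent.of_algEquiv K (hP.leavittEquiv K).symm)

end BergmanPresentation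

namespace BergmanGraph

variable {V E : Type*} {H : BergmanGraph V E}

theorem IsBasic.toPresentation [Finite V] (hH : H.IsBasic) : H.toPresentation.IsBasic := hH

theorem IsBasic.eliminate (hH : H.IsBasic) {v : V} {h : E} (hv : H.IsLonely v h) :
    (H.eliminate hH hv).IsBasic :=
  Set.eq_univ_of_forall fun _ g hg => absurd hg (hH.blue_eq g.1)

theorem IsLonely.toOrientedHypergraph {v : V} {h : E} (hv : H.IsLonely v h) :
    H.toOrientedHypergraph.IsLonely v h :=
  ⟨hv.source_self, hv.source_ne, hv.not_range, hv.other⟩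

/-- The isomorphism of the Bergman algebra with the Leavitt path algebra of a basic Bergman
graph. -/
noncomputable def IsBasic.leavittEquiv [Finite V] (hH : H.IsBasic) (K : Type*) [Field K] :
    H.BergmanAlgebra K ≃ₐ[K] H.toOrientedHypergraph.LeavittPathAlgebra K :=
  hH.toPresentation.leavittEquiv K

theorem isMoritaEquivalent_eliminate [Finite V] (K : Type*) [Field K] (hH : H.IsBasic) {v : V}
    {h : E} (hv : H.IsLonely v h) :
    IsMoritaEquivalent K ((H.eliminate hH hv).BergmanAlgebra K) (H.BergmanAlgebra K) :=
  ((IsMoritaEquivalent.of_algEquiv K ((hH.eliminate hv).leavittEquiv K)).trans K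
    (hv.toOrientedHypergraph.isMoritaEquivalent_leavittPathAlgebra K)).trans K
    (IsMoritaEquivalent.of_algEquiv K (hH.leavittEquiv K).symm)

end BergmanGraph

theorem mainTheorem5_general (K : Type*) [Field K] :
    (∀ (V E : Type*) [Finite V] (H : BergmanGraph V E) (hH : H.IsBasic)
      (v : V) (h : E) (hv : H.IsLonely v h),
      IsMoritaEquivalent K ((H.eliminate hH hv).BergmanAlgebra K) (H.BergmanAlgebra K) ∧
      ∃ e : H.toOrientedHypergraph.LeavittPathAlgebra K,
        e = H.toOrientedHypergraph.coVertL K v ∧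
        IsIdempotentElem e ∧
        TwoSidedIdeal.span {e} = ⊤ ∧
        ∃ φ : (H.eliminate hH hv).toOrientedHypergraph.LeavittPathAlgebra K →ₙₐ[K]
            H.toOrientedHypergraph.LeavittPathAlgebra K,
          Function.Injective φ ∧ Set.range φ = {x | ∃ a, x = e * a * e}) ∧
    (∀ (X I : Type*) [Finite X] (P : BergmanPresentation X I) (hP : P.IsBasic)
      (x : X) (i : I) (hx : P.IsLonely x i),
      IsMoritaEquivalent K (BergmanPresentation.BergmanAlgebra K (P.eliminate hP hx))
        (BergmanPresentation.BergmanAlgebra K P)) := by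
  refine ⟨fun V E _ H hH v h hv => ⟨BergmanGraph.isMoritaEquivalent_eliminate K hH hv, ?_⟩,
    fun X I _ P hP x i hx => BergmanPresentation.isMoritaEquivalent_eliminate K hP hx⟩
  have hlonely := hv.toOrientedHypergraph
  exact ⟨_, rfl, hlonely.isIdempotentElem_coVertL K, hlonely.span_coVertL_eq_top K,
    hlonely.cornerHom K, hlonely.cornerHom_injective K, hlonely.range_cornerHom K⟩

theorem mainTheorem5 (K : Type*) [Field K] :
    (∀ (V E : Type*) [Finite V] [Finite E] (H : BergmanGraph V E) (hH : H.IsBasic)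
      (v : V) (h : E) (hv : H.IsLonely v h),
      IsMoritaEquivalent K ((H.eliminate hH hv).BergmanAlgebra K) (H.BergmanAlgebra K) ∧
      ∃ e : H.toOrientedHypergraph.LeavittPathAlgebra K,
        e = H.toOrientedHypergraph.coVertL K v ∧
        IsIdempotentElem e ∧
        TwoSidedIdeal.span {e} = ⊤ ∧
        ∃ φ : (H.eliminate hH hv).toOrientedHypergraph.LeavittPathAlgebra K →ₙₐ[K]
            H.toOrientedHypergraph.LeavittPathAlgebra K,
          Function.Injective φ ∧ Set.range φ = {x | ∃ a, x = e * a * e}) ∧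
    (∀ (X I : Type*) [Finite X] [Finite I] (P : BergmanPresentation X I) (hP : P.IsBasic)
      (x : X) (i : I) (hx : P.IsLonely x i),
      IsMoritaEquivalent K (BergmanPresentation.BergmanAlgebra K (P.eliminate hP hx))
        (BergmanPresentation.BergmanAlgebra K P)) :=
  (mainTheorem5_general K).imp (fun h V E _ _ => h V E) fun h X I _ _ => h X I
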